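/- **Theorem 1 (convergence of gradient descent–proximal mirror ascent).** Let $\Delta\subset\mathbb R^n$ be the probability simplex, $f:\mathbb R^d\times\Delta\to\mathbb R$, $h:\Delta\to\mathbb R$, and $\mathrm{KL}(p,q)=\sum_i p_i\log(p_i/q_i)$ (with value $+\infty$ if $p_i>0=q_i$ for some $i$). Consider $\min_\theta\max_{\pi\in\Delta} f(\theta,\pi)+h(\pi)$ and put $$F(\theta)=\max_{\pi\in\Delta}\bigl(f(\theta,\pi)+h(\pi)\bigr),\qquad F_{1/2L}(\theta)=\min_w\bigl(F(w)+L\|w-\theta\|^2\bigr),\qquad F^*_{1/2L}=\inf_\theta F_{1/2L}(\theta),\qquad h^*=\max_{\Delta}h .$$ Let $L>0$, $l,\sigma,G,R\ge 0$, and assume: (i) for every $\pi\in\Delta$, $\theta\mapsto f(\theta,\pi)+h(\pi)$ is $l$-Lipschitz and differentiable with $L$-Lipschitz gradient; $f(\theta,\cdot)$ and $h$ are concave and continuous on $\Delta$; and $F$ is bounded below; (ii) for an integer $T\ge1$, starting from a deterministic $(\theta_0,\pi_0)$ with $\pi_0\in\Delta$, the iterates satisfy almost surely, for $0\le t<T$,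 with $\eta_\theta=T^{-3/4}$ and $\lambda=T^{-1/4}$, $$\theta_{t+1}=\theta_t-\eta_\theta\, g_t^\theta,\qquad \pi_{t+1}\in\operatorname*{argmax}_{\pi\in\Delta}\ h(\pi)+\langle g_t^\pi,\pi\rangle-\tfrac1{2\lambda}\mathrm{KL}(\pi,\pi_t),$$ and are adapted to a filtration $(\mathcal F_t)$; (iii) the stochastic gradients are square integrable, $\mathbb E[g_t^\theta\mid\mathcal F_t]=\nabla_\theta f(\theta_t,\pi_t)$, $\mathbb E[g_t^\pi\mid\mathcal F_t]=\nabla_\pi f(\theta_t,\pi_t)$ (a gradient of $f(\theta_t,\cdot)$ along $\Delta$), $\mathbb E\|g_t^\theta-\mathbb E[g_t^\theta\mid\mathcal F_t]\|^2\le\sigma^2$ and $\mathbb E\|g_t^\pi\|_\infty^2\le G^2$; (iv) for some $p_{\rm emp}\in\Delta$ and $\alpha>0$ with $p_{{\rm emp},i}\ge\alpha$ for all $i$, every iterate $\pi_t$, $0\le t<T$, satisfies $\mathrm{KL}(p_{\rm emp},\pi_t)\le R$ almost surely. Then $F_{1/2L}$ is differentiable, $\|\nabla F_{1/2L}(\theta_t)\|^2$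 is integrable for $t<T$, and $$\frac1T\sum_{t=0}^{T-1}\mathbb E\|\nabla F_{1/2L}(\theta_t)\|^2\ \le\ \frac{C}{T^{1/4}}+\frac{4L\,(h^*-h(\pi_0))}{T}=O(T^{-1/4}),$$ $$C=2\bigl(F_{1/2L}(\theta_0)-F^*_{1/2L}\bigr)+4L\Bigl(\frac{R+1}{\alpha}+G^2+l\sqrt{l^2+\sigma^2}\Bigr)+2L\,(l^2+\sigma^2).$$ Consequently, for every $\varepsilon>0$, if $T\ge \bigl(C+4L(h^*-h(\pi_0))\bigr)^4\varepsilon^{-8}$, then $\frac1T\sum_{t=0}^{T-1}\mathbb E\|\nabla F_{1/2L}(\theta_t)\|\le\varepsilon$ (i.e. a uniformly random iterate is $\varepsilon$-stationary in expectation), and some $t<T$ has $\mathbb E\|\nabla F_{1/2L}(\theta_t)\|\le\varepsilon$: an $\varepsilon$-stationary point is found in $O(\varepsilon^{-8})$ iterations. -/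

import Mathlib

open MeasureTheory ProbabilityTheory

noncomputable section

namespace SaddlePoint

/-- Kullback–Leibler divergence `KL(p, q) = ∑ i, p i * log (p i / q i)` of two vectors of the
probability simplex, equal to `⊤` when `p` is not absolutely continuous with respect to `q`. -/
def klDiv {n : ℕ} (p q : Fin n → ℝ) : EReal :=
  open Classical in
  if ∀ i, q i = 0 → p i = 0 then ((∑ i, p i * Real.log (p i / q i) : ℝ) : EReal) else ⊤

/-- The primal function `F(x) = max_{p ∈ Δ} (f(x, p) + h(p))`, `Δ` the probability simplex. -/
def primal {d n : ℕ} (f : EuclideanSpace ℝ (Fin d) → (Fin n → ℝ) → ℝ) (h : (Fin n → ℝ) → ℝ)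
    (x : EuclideanSpace ℝ (Fin d)) : ℝ :=
  sSup ((fun p => f x p + h p) '' stdSimplex ℝ (Fin n))

/-- Moreau envelope `F_ρ(x) = min_w (F(w) + ‖w - x‖² / (2ρ))`. For `ρ = 1 / (2L)` the quadratic
term is `L * ‖w - x‖²`. -/
def moreauEnvelope {d : ℕ} (F : EuclideanSpace ℝ (Fin d) → ℝ) (ρ : ℝ)
    (x : EuclideanSpace ℝ (Fin d)) : ℝ :=
  ⨅ w, (F w + (1 / (2 * ρ)) * ‖w - x‖ ^ 2)

/-- `v` is a gradient at `p` of the function `φ` on the probability simplex: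
`φ q = φ p + ∑ i, v i * (q i - p i) + o(‖q - p‖)` as `q → p` in the simplex. Every ambient gradient
of a differentiable extension of `φ` is one. -/
def HasSimplexGradientAt {n : ℕ} (φ : (Fin n → ℝ) → ℝ) (v p : Fin n → ℝ) : Prop :=
  HasFDerivWithinAt φ (∑ i, v i • ContinuousLinearMap.proj (R := ℝ) (φ := fun _ : Fin n => ℝ) i)
    (stdSimplex ℝ (Fin n)) p

/-- The objective `h(q) + ⟨g, q⟩ - KL(q, p) / (2 lam)` of the proximal mirror ascent step. -/
def mirrorObjective {n : ℕ} (h : (Fin n → ℝ) → ℝ) (lam : ℝ) (g p q : Fin n → ℝ) : EReal :=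
  ((h q + ∑ i, g i * q i : ℝ) : EReal) - ((1 / (2 * lam) : ℝ) : EReal) * klDiv q p

/-- `p'` is a proximal mirror ascent step from `p` with stochastic gradient `g`:
`p' ∈ argmax_{q ∈ Δ} h(q) + ⟨g, q⟩ - KL(q, p) / (2 lam)`. -/
def IsMirrorStep {n : ℕ} (h : (Fin n → ℝ) → ℝ) (lam : ℝ) (g p p' : Fin n → ℝ) : Prop :=
  p' ∈ stdSimplex ℝ (Fin n) ∧ IsMaxOn (mirrorObjective h lam g p) (stdSimplex ℝ (Fin n)) p'

/-- Regularity of the composite objective `Φ(x, p) = f(x, p) + h(p)`: `Φ` is `l`-Lipschitz and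
`L`-smooth in `x` uniformly over the simplex, and `f`, `h` are concave and continuous in `p`. -/
structure IsRegularObjective {d n : ℕ} (f : EuclideanSpace ℝ (Fin d) → (Fin n → ℝ) → ℝ)
    (h : (Fin n → ℝ) → ℝ) (L l : ℝ) : Prop where
  lipschitz : ∀ p ∈ stdSimplex ℝ (Fin n), ∀ x y,
    |(f x p + h p) - (f y p + h p)| ≤ l * ‖x - y‖
  differentiable : ∀ p ∈ stdSimplex ℝ (Fin n), Differentiable ℝ (fun x => f x p + h p)
  smooth : ∀ p ∈ stdSimplex ℝ (Fin n), ∀ x y,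
    ‖gradient (fun z => f z p + h p) x - gradient (fun z => f z p + h p) y‖ ≤ L * ‖x - y‖
  concave_f : ∀ x, ConcaveOn ℝ (stdSimplex ℝ (Fin n)) (f x)
  concave_h : ConcaveOn ℝ (stdSimplex ℝ (Fin n)) h
  continuous_f : ∀ x, ContinuousOn (f x) (stdSimplex ℝ (Fin n))
  continuous_h : ContinuousOn h (stdSimplex ℝ (Fin n))

/-- `(θ, π)` is `T` steps of stochastic gradient descent–proximal mirror ascent with step sizes
`η`, `lam`, stochastic gradients `gθ`, `gπ`, deterministic initial point `(θ₀, π₀)`, adapted to the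
filtration `ℱ`. -/
structure IsRun {d n : ℕ} {Ω : Type*} {mΩ : MeasurableSpace Ω} (μ : Measure Ω)
    (ℱ : Filtration ℕ mΩ) (h : (Fin n → ℝ) → ℝ) (T : ℕ) (η lam : ℝ)
    (θ₀ : EuclideanSpace ℝ (Fin d)) (π₀ : Fin n → ℝ)
    (θ gθ : ℕ → Ω → EuclideanSpace ℝ (Fin d)) (π gπ : ℕ → Ω → Fin n → ℝ) : Prop where
  init_mem : π₀ ∈ stdSimplex ℝ (Fin n)
  init_θ : ∀ ω, θ 0 ω = θ₀
  init_π : ∀ ω, π 0 ω = π₀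
  measurable_θ : ∀ t ≤ T, Measurable[ℱ t] (θ t)
  measurable_π : ∀ t ≤ T, Measurable[ℱ t] (π t)
  step_θ : ∀ t < T, ∀ᵐ ω ∂μ, θ (t + 1) ω = θ t ω - η • gθ t ω
  step_π : ∀ t < T, ∀ᵐ ω ∂μ, IsMirrorStep h lam (gπ t ω) (π t ω) (π (t + 1) ω)

/-- The stochastic gradients of the first `T` steps are square integrable and, given the past,
unbiased for `∇_θ f` and `∇_π f` at the current iterate; `gθ` has variance at most `σ²` and the
sup norm of `gπ` has second moment at most `G²`. -/
structure IsUnbiasedOracle {d n : ℕ} {Ω : Type*} {mΩ : MeasurableSpace Ω} (μ : Measure Ω)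
    (ℱ : Filtration ℕ mΩ) (f : EuclideanSpace ℝ (Fin d) → (Fin n → ℝ) → ℝ) (T : ℕ) (σ G : ℝ)
    (θ gθ : ℕ → Ω → EuclideanSpace ℝ (Fin d)) (π gπ : ℕ → Ω → Fin n → ℝ) : Prop where
  memLp_θ : ∀ t < T, MemLp (gθ t) 2 μ
  memLp_π : ∀ t < T, MemLp (gπ t) 2 μ
  unbiased_θ : ∀ t < T, ∀ᵐ ω ∂μ,
    (μ[gθ t | ℱ t]) ω = gradient (fun x => f x (π t ω)) (θ t ω)
  variance_θ : ∀ t < T, ∫ ω, ‖gθ t ω - (μ[gθ t | ℱ t]) ω‖ ^ 2 ∂μ ≤ σ ^ 2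
  unbiased_π : ∀ t < T, ∀ᵐ ω ∂μ,
    HasSimplexGradientAt (f (θ t ω)) ((μ[gπ t | ℱ t]) ω) (π t ω)
  bound_π : ∀ t < T, ∫ ω, ‖gπ t ω‖ ^ 2 ∂μ ≤ G ^ 2

/-- The constant multiplying `T ^ (-1/4)`. Here `D` is the initial gap of the Moreau envelope. -/
def rateConst (L l σ G R α D : ℝ) : ℝ :=
  2 * D + 4 * L * ((R + 1) / α + G ^ 2 + l * Real.sqrt (l ^ 2 + σ ^ 2))
    + 2 * L * (l ^ 2 + σ ^ 2)

end SaddlePoint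

end

/-! The Moreau envelope `M` of `F` is the potential. A maximum of `L`-smooth functions is `L`-weakly
convex, so the proximal problem is strongly convex with a unique solution `w`, `∇M(x) = 2L(x - w)`,
and `M` obeys a quadratic upper bound. Testing `w` against the smooth minorant `φ = f(·, π_t) +
h(π_t)` of `F` gives `‖∇M‖² ≤ 4L(F - φ) + 2⟨∇M, ∇φ⟩` at `θ_t` (`norm_sq_gradient_moreau_le`). The
inner products telescope along the descent steps (`sum_inner_gradient_moreau_le`); what remains is
the sum of the dual gaps `F(θ_t) - φ(θ_t)`.

The best response moves with `θ_t`, so time is cut into blocks of length `B`, and each block uses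
one comparator, nearly optimal at the first `θ` of the block. Replacing `θ_t` by that point costs
`2l` times the drift, which is `O(ηB)` in mean (`primal_sub_le`). Against a fixed comparator, mirror
ascent pays one divergence `KL / (2λ)` per block and `λ‖g‖²` per step, while `h` telescopes across
blocks (`mirror_regret_le`, `sum_range_le_of_blocks`). The divergence is at most `(R + 1) / α`,
since a bound on `KL(p_emp, π_t)` keeps the coordinates of `π_t` away from zero
(`klSum_le_of_klDiv_le`).

Both `∇M(θ_t)` and the comparator are bounded and known at time `t`, so the gradient noise
integrates to zero. On average the errors are of order `1/(ηT)`, `ηB`, `1/(λB)`, `λ` and `η`; with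
`η = T^(-3/4)`, `λ = T^(-1/4)`, `B ≈ √T` none exceeds order `T^(-1/4)`. -/

namespace SaddlePoint

/-! ### Kullback–Leibler divergence and Pinsker's inequality -/

/-- The real-valued sum `∑ i, p i * log (p i / q i)`. -/
noncomputable def klSum {n : ℕ} (p q : Fin n → ℝ) : ℝ := ∑ i, p i * Real.log (p i / q i)

lemma klDiv_eq_klSum {n : ℕ} {p q : Fin n → ℝ} (hq : ∀ i, 0 < q i) :
    klDiv p q = (klSum p q : EReal) := by
  unfold klDiv klSum
  rw [if_pos]
  exact fun i hi => absurd hi (hq i).ne'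

lemma le_mul_log_div {a b : ℝ} (ha : 0 ≤ a) (hb : 0 ≤ b) (hab : b = 0 → a = 0) :
    a - b ≤ a * Real.log (a / b) := by
  rcases ha.eq_or_lt with rfl | ha
  · simpa using hb
  have hb : 0 < b := lt_of_le_of_ne hb fun h0 => ha.ne' (hab h0.symm)
  have h1 := Real.one_sub_inv_le_log_of_pos (div_pos ha hb)
  have h2 := mul_le_mul_of_nonneg_left h1 ha.le
  have : a * (1 - (a / b)⁻¹) = a - b := by field_simp
  linarith

lemma klSum_nonneg {n : ℕ} {p q : Fin n → ℝ} (hp : p ∈ stdSimplex ℝ (Fin n))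
    (hq : q ∈ stdSimplex ℝ (Fin n)) (hpq : ∀ i, q i = 0 → p i = 0) : 0 ≤ klSum p q := by
  have h : ∑ i, (p i - q i) ≤ klSum p q :=
    Finset.sum_le_sum fun i _ => le_mul_log_div (hp.1 i) (hq.1 i) (hpq i)
  rw [Finset.sum_sub_distrib, hp.2, hq.2] at h
  linarith

/-- The difference of the two sides vanishes at `1` and has derivative `(y - 1)³ / (y²(y + 2)²)`, so
`1` is its minimum. This is the scalar form of `three_mul_sq_sub_le` with `x = a / b`. -/
lemma log_ge_rational {x : ℝ} (hx : 0 < x) :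
    (x - 1) * (5 * x + 1) / (2 * x * (x + 2)) ≤ Real.log x := by
  set m : ℝ → ℝ := fun x => Real.log x - (x - 1) * (5 * x + 1) / (2 * x * (x + 2)) with hm
  have hd : ∀ y : ℝ, 0 < y → HasDerivAt m ((y - 1) ^ 3 / (y ^ 2 * (y + 2) ^ 2)) y := by
    intro y hy
    have h1 : HasDerivAt (fun x : ℝ => (x - 1) * (5 * x + 1)) (10 * y - 4) y := by
      have := ((hasDerivAt_id y).sub_const 1).mul (((hasDerivAt_id y).const_mul 5).add_const 1)
      refine this.congr_deriv ?_
      simp only [id]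
      ring
    have h2 : HasDerivAt (fun x : ℝ => 2 * x * (x + 2)) (4 * y + 4) y := by
      have := ((hasDerivAt_id y).const_mul 2).mul ((hasDerivAt_id y).add_const 2)
      refine this.congr_deriv ?_
      simp only [id]
      ring
    have h3 := (Real.hasDerivAt_log hy.ne').sub (h1.div h2 (by positivity))
    refine h3.congr_deriv ?_
    field_simp
    ring
  have hm1 : m 1 = 0 := by simp [hm]
  suffices 0 ≤ m x by simp only [hm] at this; linarith
  rcases le_total x 1 with h | h
  · have : AntitoneOn m (Set.Icc x 1) := by
      apply antitoneOn_of_deriv_nonpos (convex_Icc _ _)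
      · exact fun y hy => (hd y (hx.trans_le hy.1)).continuousAt.continuousWithinAt
      · intro y hy
        rw [interior_Icc] at hy
        exact (hd y (hx.trans hy.1)).differentiableAt.differentiableWithinAt
      · intro y hy
        rw [interior_Icc] at hy
        rw [(hd y (hx.trans hy.1)).deriv]
        apply div_nonpos_of_nonpos_of_nonneg _ (by positivity)
        have : y - 1 ≤ 0 := by linarith [hy.2]
        exact Odd.pow_nonpos (by decide) this
    rw [← hm1]
    exact this ⟨le_rfl, h⟩ ⟨h, le_rfl⟩ h
  · have : MonotoneOn m (Set.Icc 1 x) := by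
      apply monotoneOn_of_deriv_nonneg (convex_Icc _ _)
      · exact fun y hy => (hd y (one_pos.trans_le hy.1)).continuousAt.continuousWithinAt
      · intro y hy
        rw [interior_Icc] at hy
        exact (hd y (one_pos.trans hy.1)).differentiableAt.differentiableWithinAt
      · intro y hy
        rw [interior_Icc] at hy
        rw [(hd y (one_pos.trans hy.1)).deriv]
        have : 0 ≤ y - 1 := by linarith [hy.1]
        positivity
    rw [← hm1]
    exact this ⟨le_rfl, h⟩ ⟨h, le_rfl⟩ h

lemma three_mul_sq_sub_le {a b : ℝ} (ha : 0 ≤ a) (hb : 0 < b) :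
    3 * (a - b) ^ 2 ≤ (4 * b + 2 * a) * (a * Real.log (a / b) - a + b) := by
  rcases ha.eq_or_lt with rfl | ha
  · simp
    nlinarith [sq_nonneg b]
  have h := log_ge_rational (div_pos ha hb)
  have h2 : (4 * b + 2 * a) * (a * ((a / b - 1) * (5 * (a / b) + 1) /
      (2 * (a / b) * (a / b + 2))) - a + b) = 3 * (a - b) ^ 2 := by
    field_simp
    ring
  rw [← h2]
  gcongr

/-- Pinsker's inequality on the simplex. -/
lemma sq_sum_abs_sub_le_klSum {n : ℕ} {p q : Fin n → ℝ} (hp : p ∈ stdSimplex ℝ (Fin n))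
    (hq : q ∈ stdSimplex ℝ (Fin n)) (hq0 : ∀ i, 0 < q i) :
    (∑ i, |p i - q i|) ^ 2 ≤ 2 * klSum p q := by
  -- Cauchy–Schwarz with these weights: their total mass is `2`, the constant of Pinsker's
  -- inequality, and the weighted squares are bounded termwise by the summands of the divergence.
  have hw : ∀ i, 0 < (4 * q i + 2 * p i) / 3 := fun i => by
    have := hq0 i; have := hp.1 i; positivity
  have hs : ∑ i, (4 * q i + 2 * p i) / 3 = 2 := by
    rw [← Finset.sum_div, Finset.sum_add_distrib, ← Finset.mul_sum, ← Finset.mul_sum, hp.2, hq.2]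
    norm_num
  have h1 := Finset.sum_sq_le_sum_mul_sum_of_sq_le_mul Finset.univ
    (r := fun i => |p i - q i|) (f := fun i => (4 * q i + 2 * p i) / 3)
    (g := fun i => (p i - q i) ^ 2 / ((4 * q i + 2 * p i) / 3))
    (fun i _ => (hw i).le) (fun i _ => div_nonneg (sq_nonneg _) (hw i).le)
    (fun i _ => by rw [sq_abs, mul_div_cancel₀ _ (hw i).ne'])
  rw [hs] at h1
  refine h1.trans (mul_le_mul_of_nonneg_left ?_ zero_le_two)
  have h2 : ∑ i, (p i - q i) ^ 2 / ((4 * q i + 2 * p i) / 3)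
      ≤ ∑ i, (p i * Real.log (p i / q i) - p i + q i) := by
    refine Finset.sum_le_sum fun i _ => ?_
    rw [div_le_iff₀ (hw i)]
    have := three_mul_sq_sub_le (hp.1 i) (hq0 i)
    linarith
  refine h2.trans (le_of_eq ?_)
  rw [Finset.sum_add_distrib, Finset.sum_sub_distrib, hp.2, hq.2, klSum]
  ring

lemma sum_mul_le_norm_mul_sum_abs {n : ℕ} (g v : Fin n → ℝ) :
    ∑ i, g i * v i ≤ ‖g‖ * ∑ i, |v i| := by
  rw [Finset.mul_sum]
  refine Finset.sum_le_sum fun i _ => ?_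
  calc g i * v i ≤ |g i * v i| := le_abs_self _
    _ = ‖g i‖ * |v i| := by rw [abs_mul, Real.norm_eq_abs]
    _ ≤ ‖g‖ * |v i| := by gcongr; exact norm_le_pi_norm g i

/-- Duality of the sup norm and the `ℓ¹` norm, then Young's inequality, then Pinsker. The divergence
term is exactly the one that a mirror step supplies with a negative sign. -/
lemma sum_mul_sub_le_klSum {n : ℕ} {p q : Fin n → ℝ} (hp : p ∈ stdSimplex ℝ (Fin n))
    (hq : q ∈ stdSimplex ℝ (Fin n)) (hq0 : ∀ i, 0 < q i) (g : Fin n → ℝ) {lam : ℝ}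
    (hlam : 0 < lam) :
    ∑ i, g i * (p i - q i) ≤ lam * ‖g‖ ^ 2 + 1 / (2 * lam) * klSum p q := by
  have h1 := sum_mul_le_norm_mul_sum_abs g (fun i => p i - q i)
  have h2 := sq_sum_abs_sub_le_klSum hp hq hq0
  set s := ∑ i, |p i - q i|
  have h3 : 1 / (2 * lam) * (s ^ 2 / 2) ≤ 1 / (2 * lam) * klSum p q := by
    gcongr; linarith
  have h4 : ‖g‖ * s ≤ lam * ‖g‖ ^ 2 + 1 / (2 * lam) * (s ^ 2 / 2) := by
    have : lam * ‖g‖ ^ 2 + 1 / (2 * lam) * (s ^ 2 / 2) - ‖g‖ * s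
        = (2 * lam * ‖g‖ - s) ^ 2 / (4 * lam) := by
      field_simp; ring
    have h5 : 0 ≤ (2 * lam * ‖g‖ - s) ^ 2 / (4 * lam) := by positivity
    linarith
  linarith

/-- For `z` the convex combination, `log (c / p) - log (c / z) = log (z / p)` does not depend on
`c`; average over `c = a` and `c = b`. Zero values of `c` are harmless because of the factor `c`. -/
lemma mul_log_div_convexCombo {a b p e : ℝ} (ha : 0 ≤ a) (hb : 0 ≤ b) (hp : 0 < p)
    (he : 0 < e) (he1 : e < 1) :
    ((1 - e) * a + e * b) * Real.log (((1 - e) * a + e * b) / p)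
      = (1 - e) * (a * Real.log (a / p)) + e * (b * Real.log (b / p))
        - (1 - e) * (a * Real.log (a / ((1 - e) * a + e * b)))
        - e * (b * Real.log (b / ((1 - e) * a + e * b))) := by
  have h1e : 0 < 1 - e := by linarith
  rcases (add_nonneg (mul_nonneg h1e.le ha) (mul_nonneg he.le hb)).eq_or_lt with h0 | hz
  · have ha0 : a = 0 := by nlinarith [mul_nonneg h1e.le ha, mul_nonneg he.le hb]
    have hb0 : b = 0 := by nlinarith [mul_nonneg h1e.le ha, mul_nonneg he.le hb]
    simp [ha0, hb0]
  have key : ∀ c : ℝ, 0 ≤ c → c * Real.log (c / ((1 - e) * a + e * b))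
      = c * Real.log (c / p) - c * Real.log (((1 - e) * a + e * b) / p) := by
    intro c hc
    rcases hc.eq_or_lt with rfl | hc
    · simp
    rw [Real.log_div hc.ne' hz.ne', Real.log_div hc.ne' hp.ne', Real.log_div hz.ne' hp.ne']
    ring
  rw [key a ha, key b hb]
  ring

/-- Exact convexity gap of `KL(·, p)` along a segment. -/
lemma klSum_convexCombo {n : ℕ} {a b p : Fin n → ℝ} (ha : ∀ i, 0 ≤ a i) (hb : ∀ i, 0 ≤ b i)
    (hp : ∀ i, 0 < p i) {e : ℝ} (he : 0 < e) (he1 : e < 1) :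
    klSum ((1 - e) • a + e • b) p = (1 - e) * klSum a p + e * klSum b p
      - (1 - e) * klSum a ((1 - e) • a + e • b) - e * klSum b ((1 - e) • a + e • b) := by
  simp only [klSum, Finset.mul_sum, ← Finset.sum_add_distrib, ← Finset.sum_sub_distrib]
  refine Finset.sum_congr rfl fun i _ => ?_
  simpa using mul_log_div_convexCombo (ha i) (hb i) (hp i) he he1

/-! ### One step of proximal mirror ascent -/

lemma IsMirrorStep.real_le {n : ℕ} {h : (Fin n → ℝ) → ℝ} {lam : ℝ} {g p p' q : Fin n → ℝ}
    (hs : IsMirrorStep h lam g p p') (hp : ∀ i, 0 < p i) (hq : q ∈ stdSimplex ℝ (Fin n)) :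
    h q + ∑ i, g i * q i - 1 / (2 * lam) * klSum q p
      ≤ h p' + ∑ i, g i * p' i - 1 / (2 * lam) * klSum p' p := by
  have := hs.2 hq
  simp only [Set.mem_ofPred_eq, mirrorObjective, klDiv_eq_klSum hp] at this
  exact_mod_cast this

/-- A substitute for first-order optimality that needs no derivative of `h`: maximality of `p'` is
tested at a point of the segment towards `q`, the exact convexity gap of the divergence is inserted,
and the result is divided by `e`. -/
lemma IsMirrorStep.interpolated_le {n : ℕ} {h : (Fin n → ℝ) → ℝ} {lam : ℝ}
    {g p p' q : Fin n → ℝ} (hh : ConcaveOn ℝ (stdSimplex ℝ (Fin n)) h) (hlam : 0 < lam)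
    (hs : IsMirrorStep h lam g p p') (hp : ∀ i, 0 < p i) (hq : q ∈ stdSimplex ℝ (Fin n))
    {e : ℝ} (he : 0 < e) (he1 : e < 1) :
    h q - h p' + ∑ i, g i * (q i - p' i)
      ≤ 1 / (2 * lam) * (klSum q p - klSum p' p - klSum q ((1 - e) • p' + e • q)) := by
  have h1e : 0 < 1 - e := by linarith
  have hz : (1 - e) • p' + e • q ∈ stdSimplex ℝ (Fin n) :=
    convex_stdSimplex ℝ _ hs.1 hq h1e.le he.le (by ring)
  have h1 := hs.real_le hp hz
  have h2 : (1 - e) * h p' + e * h q ≤ h ((1 - e) • p' + e • q) := by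
    simpa using hh.2 hs.1 hq h1e.le he.le (by ring)
  rw [klSum_convexCombo hs.1.1 hq.1 hp he he1] at h1
  have h3 : 0 ≤ klSum p' ((1 - e) • p' + e • q) := by
    refine klSum_nonneg hs.1 hz fun i hi => ?_
    simp only [Pi.add_apply, Pi.smul_apply, smul_eq_mul] at hi
    have := mul_nonneg h1e.le (hs.1.1 i)
    have := mul_nonneg he.le (hq.1 i)
    nlinarith [hs.1.1 i]
  have h4 : ∑ i, g i * ((1 - e) • p' + e • q) i
      = ∑ i, g i * p' i + e * ∑ i, g i * (q i - p' i) := by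
    rw [Finset.mul_sum, ← Finset.sum_add_distrib]
    refine Finset.sum_congr rfl fun i _ => ?_
    simp only [Pi.add_apply, Pi.smul_apply, smul_eq_mul]
    ring
  rw [h4] at h1
  have h5 : 0 ≤ 1 / (2 * lam) * ((1 - e) * klSum p' ((1 - e) • p' + e • q)) := by positivity
  have h6 : e * (h q - h p' + ∑ i, g i * (q i - p' i))
      ≤ e * (1 / (2 * lam) * (klSum q p - klSum p' p - klSum q ((1 - e) • p' + e • q))) := by
    generalize 1 / (2 * lam) = c at *
    linear_combination h1 + h2 + h5
  exact le_of_mul_le_mul_left h6 he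

/-- One proximal mirror ascent step, without the final divergence. -/
lemma IsMirrorStep.step_le {n : ℕ} {h : (Fin n → ℝ) → ℝ} {lam : ℝ}
    {g p p' q : Fin n → ℝ} (hh : ConcaveOn ℝ (stdSimplex ℝ (Fin n)) h) (hlam : 0 < lam)
    (hs : IsMirrorStep h lam g p p') (hpm : p ∈ stdSimplex ℝ (Fin n)) (hp : ∀ i, 0 < p i)
    (hq : q ∈ stdSimplex ℝ (Fin n)) :
    h q - h p' + ∑ i, g i * (q i - p i) ≤ 1 / (2 * lam) * klSum q p + lam * ‖g‖ ^ 2 := by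
  -- Any `e` in `(0, 1)` serves, since the last divergence is dropped. Avoiding the limit `e → 0`
  -- allows `p'` to lie on the boundary of the simplex.
  have h1 := hs.interpolated_le hh hlam hp hq (e := 1 / 2) (by norm_num) (by norm_num)
  have h3 : 0 ≤ klSum q ((1 - 1 / 2 : ℝ) • p' + (1 / 2 : ℝ) • q) := by
    refine klSum_nonneg hq (convex_stdSimplex ℝ _ hs.1 hq (by norm_num) (by norm_num)
      (by norm_num)) fun i hi => ?_
    simp only [Pi.add_apply, Pi.smul_apply, smul_eq_mul] at hi
    linarith [hs.1.1 i, hq.1 i]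
  have h2 := sum_mul_sub_le_klSum hs.1 hpm hp g hlam
  have h4 : ∑ i, g i * (q i - p i) = ∑ i, g i * (q i - p' i) + ∑ i, g i * (p' i - p i) := by
    rw [← Finset.sum_add_distrib]
    exact Finset.sum_congr rfl fun i _ => by ring
  have h5 : 0 ≤ 1 / (2 * lam) * klSum q ((1 - 1 / 2 : ℝ) • p' + (1 / 2 : ℝ) • q) := by
    positivity
  rw [h4]
  generalize 1 / (2 * lam) = c at *
  linear_combination h1 + h2 + h5

/-- One proximal mirror ascent step. -/
lemma IsMirrorStep.step_le_sub {n : ℕ} {h : (Fin n → ℝ) → ℝ} {lam : ℝ}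
    {g p p' q : Fin n → ℝ} (hh : ConcaveOn ℝ (stdSimplex ℝ (Fin n)) h) (hlam : 0 < lam)
    (hs : IsMirrorStep h lam g p p') (hpm : p ∈ stdSimplex ℝ (Fin n)) (hp : ∀ i, 0 < p i)
    (hp' : ∀ i, 0 < p' i) (hq : q ∈ stdSimplex ℝ (Fin n)) :
    h q - h p' + ∑ i, g i * (q i - p i)
      ≤ 1 / (2 * lam) * (klSum q p - klSum q p') + lam * ‖g‖ ^ 2 := by
  -- Positivity of `p'` is what makes the divergence continuous at `e = 0`.
  have hc : Filter.Tendsto (fun e : ℝ => klSum q ((1 - e) • p' + e • q)) (nhdsWithin 0 (Set.Ioi 0))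
      (nhds (klSum q p')) := by
    apply tendsto_nhdsWithin_of_tendsto_nhds
    have : ContinuousAt (fun e : ℝ => klSum q ((1 - e) • p' + e • q)) 0 := by
      unfold klSum
      refine tendsto_finsetSum _ fun i _ => ?_
      rcases (hq.1 i).eq_or_lt with h0 | h0
      · simp [← h0]
      · refine Filter.Tendsto.const_mul _ (ContinuousAt.log (ContinuousAt.div (by fun_prop)
          ?_ ?_) ?_)
        · simp only [Pi.add_apply, Pi.smul_apply]; fun_prop
        · simpa using (hp' i).ne'
        · simpa using ⟨h0.ne', (hp' i).ne'⟩
    simpa [ContinuousAt] using this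
  have h1 : h q - h p' + ∑ i, g i * (q i - p' i)
      ≤ 1 / (2 * lam) * (klSum q p - klSum p' p - klSum q p') := by
    refine ge_of_tendsto ((hc.const_sub (klSum q p - klSum p' p)).const_mul (1 / (2 * lam))) ?_
    filter_upwards [Ioo_mem_nhdsGT (zero_lt_one (α := ℝ))] with e he
    exact hs.interpolated_le hh hlam hp hq he.1 he.2
  have h2 := sum_mul_sub_le_klSum hs.1 hpm hp g hlam
  have h4 : ∑ i, g i * (q i - p i) = ∑ i, g i * (q i - p' i) + ∑ i, g i * (p' i - p i) := by
    rw [← Finset.sum_add_distrib]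
    exact Finset.sum_congr rfl fun i _ => by ring
  rw [h4]
  generalize 1 / (2 * lam) = c at *
  linear_combination h1 + h2

/-! ### Uniform divergence bound from `KL(p_emp, ·) ≤ R` -/

lemma pos_of_klDiv_le {n : ℕ} {p q : Fin n → ℝ} {R : ℝ} (hp : ∀ i, 0 < p i)
    (hq : ∀ i, 0 ≤ q i) (hR : klDiv p q ≤ (R : EReal)) : ∀ i, 0 < q i := by
  intro i
  refine lt_of_le_of_ne (hq i) fun h0 => ?_
  rw [klDiv, if_neg] at hR
  · simp at hR
  · exact fun hc => (hp i).ne' (hc i h0.symm)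

/-- The other terms of the divergence together with `p i * log (p i)` are at least `-log 2`. This
follows from `a - b ≤ a * log (a / b)` with reference masses `1 / 2` at `i` and `q j / 2` elsewhere,
whose total is at most `1`. -/
lemma mul_neg_log_le_klSum {n : ℕ} {p q : Fin n → ℝ} (hp : p ∈ stdSimplex ℝ (Fin n))
    (hq : q ∈ stdSimplex ℝ (Fin n)) (hq0 : ∀ i, 0 < q i) (i : Fin n) :
    p i * (-Real.log (q i)) ≤ klSum p q + 1 := by
  have hpi := Finset.add_sum_erase Finset.univ p (Finset.mem_univ i)
  have hqi := Finset.add_sum_erase Finset.univ q (Finset.mem_univ i)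
  have hki := Finset.add_sum_erase Finset.univ (fun j => p j * Real.log (p j / q j))
    (Finset.mem_univ i)
  rw [hp.2] at hpi
  rw [hq.2] at hqi
  have hP : ∀ s : ℝ, 0 < s →
      ∑ j ∈ Finset.univ.erase i, (p j - s * q j + p j * Real.log s)
        ≤ ∑ j ∈ Finset.univ.erase i, p j * Real.log (p j / q j) := by
    intro s hs
    refine Finset.sum_le_sum fun j _ => ?_
    have h1 := le_mul_log_div (hp.1 j) (mul_pos hs (hq0 j)).le
      (fun h0 => absurd h0 (mul_pos hs (hq0 j)).ne')
    rcases (hp.1 j).eq_or_lt with h0 | h0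
    · rw [← h0] at h1 ⊢
      simp at h1 ⊢
      linarith
    have h2 : Real.log (p j / (s * q j)) = Real.log (p j / q j) - Real.log s := by
      rw [Real.log_div h0.ne' (mul_pos hs (hq0 j)).ne', Real.log_mul hs.ne' (hq0 j).ne',
        Real.log_div h0.ne' (hq0 j).ne']
      ring
    rw [h2] at h1
    linarith
  have h2 := hP (1 / 2) (by norm_num)
  simp only [Finset.sum_add_distrib, Finset.sum_sub_distrib, ← Finset.mul_sum,
    ← Finset.sum_mul] at h2
  have hl2 : Real.log (1 / 2) = - Real.log 2 := by rw [one_div, Real.log_inv]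
  have hlog2 := Real.log_two_lt_d9
  have hlog2' := Real.log_two_gt_d9
  have h3 : p i * Real.log (p i / q i) + p i * (Real.log (q i)) ≥ p i - (1/2) - p i * Real.log 2 := by
    rcases (hp.1 i).eq_or_lt with h0 | h0
    · rw [← h0]; simp
    · have h4 := le_mul_log_div h0.le (b := 1 / 2) (by norm_num) (by norm_num)
      rw [Real.log_div h0.ne' (by norm_num), hl2] at h4
      rw [Real.log_div h0.ne' (hq0 i).ne']
      linarith
  rw [hl2] at h2
  have hP' : ∑ j ∈ Finset.univ.erase i, p j = 1 - p i := by linarith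
  have hQ' : ∑ j ∈ Finset.univ.erase i, q j = 1 - q i := by linarith
  rw [hP', hQ'] at h2
  have := hq0 i
  unfold klSum
  nlinarith

/-- If `KL(p, q) ≤ R` for some `p` bounded below by `α`, then `KL(r, q) ≤ (R + 1) / α` for all
`r` in the simplex. -/
lemma klSum_le_of_klDiv_le {n : ℕ} {p q r : Fin n → ℝ} {R α : ℝ}
    (hp : p ∈ stdSimplex ℝ (Fin n)) (hα : 0 < α) (hαp : ∀ i, α ≤ p i)
    (hq : q ∈ stdSimplex ℝ (Fin n)) (hr : r ∈ stdSimplex ℝ (Fin n))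
    (hR : klDiv p q ≤ (R : EReal)) : klSum r q ≤ (R + 1) / α := by
  have hq0 := pos_of_klDiv_le (fun i => hα.trans_le (hαp i)) hq.1 hR
  rw [klDiv_eq_klSum hq0, EReal.coe_le_coe_iff] at hR
  have hle1 : ∀ {s : Fin n → ℝ}, s ∈ stdSimplex ℝ (Fin n) → ∀ i, s i ≤ 1 := fun hs i => by
    rw [← hs.2]; exact Finset.single_le_sum (fun j _ => hs.1 j) (Finset.mem_univ i)
  have key : ∀ i, -Real.log (q i) ≤ (R + 1) / α := by
    intro i
    have h1 := mul_neg_log_le_klSum hp hq hq0 i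
    have h2 : 0 ≤ -Real.log (q i) := by
      linarith [Real.log_nonpos (hq.1 i) (hle1 hq i)]
    rw [le_div_iff₀ hα]
    nlinarith [mul_le_mul_of_nonneg_right (hαp i) h2]
  calc klSum r q ≤ ∑ i, r i * ((R + 1) / α) := by
        refine Finset.sum_le_sum fun i _ => ?_
        rcases (hr.1 i).eq_or_lt with h0 | h0
        · simp [← h0]
        refine mul_le_mul_of_nonneg_left ?_ h0.le
        rw [Real.log_div h0.ne' (hq0 i).ne']
        linarith [key i, Real.log_nonpos h0.le (hle1 hr i)]
    _ = (R + 1) / α := by rw [← Finset.sum_mul, hr.2, one_mul]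

/-! ### Smooth and weakly convex functions -/

section Smooth

variable {E : Type*} [NormedAddCommGroup E] [InnerProductSpace ℝ E] [CompleteSpace E]

/-- Quadratic lower bound for a function with Lipschitz gradient. -/
lemma add_inner_gradient_sub_le {φ : E → ℝ} {L : ℝ} (hd : Differentiable ℝ φ)
    (hs : ∀ x y, ‖gradient φ x - gradient φ y‖ ≤ L * ‖x - y‖) (x y : E) :
    φ x + inner ℝ (gradient φ x) (y - x) - L / 2 * ‖y - x‖ ^ 2 ≤ φ y := by
  set ψ : ℝ → ℝ := fun s => φ (x + s • (y - x)) - s * inner ℝ (gradient φ x) (y - x)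
    + L / 2 * ‖y - x‖ ^ 2 * s ^ 2 with hψ
  have hder : ∀ s, HasDerivAt ψ (inner ℝ (gradient φ (x + s • (y - x))) (y - x)
      - inner ℝ (gradient φ x) (y - x) + L * ‖y - x‖ ^ 2 * s) s := by
    intro s
    have hline : HasDerivAt (fun s : ℝ => x + s • (y - x)) (y - x) s := by
      simpa using ((hasDerivAt_id s).smul_const (y - x)).const_add x
    have h1 := (hd (x + s • (y - x))).hasGradientAt.hasFDerivAt.comp_hasDerivAt s hline
    have h2 := (h1.sub ((hasDerivAt_id s).mul_const (inner ℝ (gradient φ x) (y - x)))).add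
      ((hasDerivAt_pow 2 s).const_mul (L / 2 * ‖y - x‖ ^ 2))
    refine h2.congr_deriv ?_
    simp
    ring
  have hmono : MonotoneOn ψ (Set.Icc 0 1) := by
    apply monotoneOn_of_deriv_nonneg (convex_Icc _ _)
    · exact fun s _ => (hder s).continuousAt.continuousWithinAt
    · exact fun s _ => (hder s).differentiableAt.differentiableWithinAt
    · intro s hs'
      rw [interior_Icc] at hs'
      rw [(hder s).deriv, ← inner_sub_left]
      have h1 := abs_real_inner_le_norm (gradient φ (x + s • (y - x)) - gradient φ x) (y - x)
      have h2 := hs (x + s • (y - x)) x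
      rw [add_sub_cancel_left, norm_smul, Real.norm_of_nonneg hs'.1.le] at h2
      have h3 := mul_le_mul_of_nonneg_right h2 (norm_nonneg (y - x))
      have h4 := neg_abs_le (inner ℝ (gradient φ (x + s • (y - x)) - gradient φ x) (y - x))
      linarith
  have h01 := hmono ⟨le_rfl, zero_le_one⟩ ⟨zero_le_one, le_rfl⟩ zero_le_one
  simp only [hψ, zero_smul, one_smul, add_zero, add_sub_cancel] at h01
  linarith

lemma norm_gradient_le_of_lipschitz {φ : E → ℝ} {l : ℝ} (hl : 0 ≤ l)
    (h : ∀ x y, |φ x - φ y| ≤ l * ‖x - y‖) (x : E) : ‖gradient φ x‖ ≤ l := by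
  rw [gradient, LinearIsometryEquiv.norm_map]
  exact norm_fderiv_le_of_lip' ℝ hl (Filter.Eventually.of_forall fun y => by
    rw [Real.norm_eq_abs]; exact h y x)

lemma norm_sq_sub_convexCombo {E : Type*} [NormedAddCommGroup E] [InnerProductSpace ℝ E]
    (a b : E) (e : ℝ) (x : E) :
    ‖((1 - e) • a + e • b) - x‖ ^ 2
      = (1 - e) * ‖a - x‖ ^ 2 + e * ‖b - x‖ ^ 2 - e * (1 - e) * ‖a - b‖ ^ 2 := by
  have h1 : ((1 - e) • a + e • b) - x = (1 - e) • (a - x) + e • (b - x) := by module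
  have h2 : a - b = (a - x) - (b - x) := by abel
  rw [h1, h2]
  generalize a - x = u
  generalize b - x = v
  rw [norm_add_sq_real, norm_sub_sq_real, norm_smul, norm_smul, real_inner_smul_left,
    real_inner_smul_right, mul_pow, mul_pow, Real.norm_eq_abs, Real.norm_eq_abs, sq_abs, sq_abs]
  ring

/-- `F` is `L`-weakly convex: `F + (L / 2) ‖·‖²` is convex. -/
def IsWeaklyConvex (F : E → ℝ) (L : ℝ) : Prop :=
  ∀ a b : E, ∀ e : ℝ, 0 < e → e < 1 →
    F ((1 - e) • a + e • b) ≤ (1 - e) * F a + e * F b + L / 2 * (e * (1 - e) * ‖a - b‖ ^ 2)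

/-- Average the quadratic lower bounds based at the intermediate point; the linear terms cancel. -/
lemma isWeaklyConvex_of_lipschitz_gradient {φ : E → ℝ} {L : ℝ} (hd : Differentiable ℝ φ)
    (hs : ∀ x y, ‖gradient φ x - gradient φ y‖ ≤ L * ‖x - y‖) : IsWeaklyConvex φ L := by
  intro a b e he he1
  set z := (1 - e) • a + e • b with hz
  have ha := add_inner_gradient_sub_le hd hs z a
  have hb := add_inner_gradient_sub_le hd hs z b
  have h1e : 0 < 1 - e := by linarith
  have ha' := mul_le_mul_of_nonneg_left ha h1e.le
  have hb' := mul_le_mul_of_nonneg_left hb he.le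
  have hza : a - z = e • (a - b) := by rw [hz]; module
  have hzb : b - z = -(1 - e) • (a - b) := by rw [hz]; module
  rw [hza, inner_smul_right, norm_smul, Real.norm_eq_abs, mul_pow, sq_abs] at ha'
  rw [hzb, inner_smul_right, norm_smul, Real.norm_eq_abs, mul_pow, sq_abs] at hb'
  linear_combination ha' + hb'

end Smooth

/-! ### Proximal points and the Moreau envelope -/

section Moreau

variable {d : ℕ} {F : EuclideanSpace ℝ (Fin d) → ℝ} {L l : ℝ}

/-- `w` is the proximal point of `F` at `x` for the parameter `1 / (2 * L)`, with the quadratic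
growth that `L`-weak convexity of `F` provides. -/
structure IsProxPoint (F : EuclideanSpace ℝ (Fin d) → ℝ) (L : ℝ)
    (x w : EuclideanSpace ℝ (Fin d)) : Prop where
  eq : moreauEnvelope F (1 / (2 * L)) x = F w + L * ‖w - x‖ ^ 2
  growth : ∀ y, moreauEnvelope F (1 / (2 * L)) x + L / 2 * ‖y - w‖ ^ 2 ≤ F y + L * ‖y - x‖ ^ 2

/-- Outside the ball of radius `l / L` the quadratic term outweighs any decrease of `F`, so a
minimizer exists by compactness. The growth constant `L / 2` is what remains of the modulus `2L` of
the quadratic after weak convexity uses up `L`. -/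
lemma exists_isProxPoint (hL : 0 < L) (hl : 0 ≤ l) (hF : ∀ x y, |F x - F y| ≤ l * ‖x - y‖)
    (hw : IsWeaklyConvex F L) (x : EuclideanSpace ℝ (Fin d)) : ∃ w, IsProxPoint F L x w := by
  have hcont : Continuous F := by
    have : LipschitzWith ⟨l, hl⟩ F := LipschitzWith.of_dist_le_mul fun x y => by
      rw [Real.dist_eq, dist_eq_norm]; exact hF x y
    exact this.continuous
  have hmin : ∃ w, ∀ y, F w + L * ‖w - x‖ ^ 2 ≤ F y + L * ‖y - x‖ ^ 2 := by
    have hne : (Metric.closedBall x (l / L)).Nonempty :=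
      ⟨x, Metric.mem_closedBall_self (by positivity)⟩
    obtain ⟨w, -, hwmin⟩ := (isCompact_closedBall x (l / L)).exists_isMinOn hne
      (f := fun y => F y + L * ‖y - x‖ ^ 2) (by fun_prop)
    refine ⟨w, fun y => ?_⟩
    by_cases hy : y ∈ Metric.closedBall x (l / L)
    · exact hwmin hy
    · have hx : F w + L * ‖w - x‖ ^ 2 ≤ F x + L * ‖x - x‖ ^ 2 :=
        hwmin (Metric.mem_closedBall_self (by positivity))
      rw [Metric.mem_closedBall, dist_eq_norm, not_le, div_lt_iff₀ hL] at hy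
      have h1 := (abs_le.1 (hF x y)).2
      rw [norm_sub_rev] at h1
      simp only [sub_self, norm_zero] at hx
      nlinarith [norm_nonneg (y - x)]
  obtain ⟨w, hwmin⟩ := hmin
  have hM : moreauEnvelope F (1 / (2 * L)) x = F w + L * ‖w - x‖ ^ 2 := by
    have hc : 1 / (2 * (1 / (2 * L))) = L := by field_simp
    rw [moreauEnvelope, hc]
    exact le_antisymm (ciInf_le ⟨_, Set.forall_mem_range.2 hwmin⟩ w) (le_ciInf hwmin)
  refine ⟨w, hM, fun y => ?_⟩
  rw [hM]
  -- Minimality against a point of the segment from `w` to `y`, divided by `e`; the factor `1 - e`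
  -- disappears as `e → 0`.
  have key : ∀ e : ℝ, 0 < e → e < 1 →
      F w + L * ‖w - x‖ ^ 2 + L / 2 * (1 - e) * ‖y - w‖ ^ 2 ≤ F y + L * ‖y - x‖ ^ 2 := by
    intro e he he1
    have h1 := hwmin ((1 - e) • w + e • y)
    have h2 := hw w y e he he1
    rw [norm_sq_sub_convexCombo] at h1
    rw [norm_sub_rev w y] at h1 h2
    refine le_of_mul_le_mul_left ?_ he
    linear_combination h1 + h2
  have ht : Filter.Tendsto
      (fun e : ℝ => F w + L * ‖w - x‖ ^ 2 + L / 2 * (1 - e) * ‖y - w‖ ^ 2)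
      (nhdsWithin 0 (Set.Ioi 0)) (nhds (F w + L * ‖w - x‖ ^ 2 + L / 2 * ‖y - w‖ ^ 2)) := by
    apply tendsto_nhdsWithin_of_tendsto_nhds
    have : Continuous
      (fun e : ℝ => F w + L * ‖w - x‖ ^ 2 + L / 2 * (1 - e) * ‖y - w‖ ^ 2) := by fun_prop
    simpa using this.tendsto 0
  refine le_of_tendsto ht ?_
  filter_upwards [Ioo_mem_nhdsGT (zero_lt_one (α := ℝ))] with e he
  exact key e he.1 he.2

/-- The proximal point at `x` is a competitor in the problem at `y`; expand the square. -/
lemma IsProxPoint.moreau_le {x w : EuclideanSpace ℝ (Fin d)} (hw : IsProxPoint F L x w)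
    {y w' : EuclideanSpace ℝ (Fin d)} (hw' : IsProxPoint F L y w') (hL : 0 < L) :
    moreauEnvelope F (1 / (2 * L)) y ≤ moreauEnvelope F (1 / (2 * L)) x
      + inner ℝ ((2 * L) • (x - w)) (y - x) + L * ‖y - x‖ ^ 2 := by
  have h1 := hw'.growth w
  have h2 : w - y = -((x - w) + (y - x)) := by abel
  have h3 : 0 ≤ L / 2 * ‖w - w'‖ ^ 2 := by positivity
  rw [h2, norm_neg, norm_add_sq_real] at h1
  rw [hw.eq, real_inner_smul_left, norm_sub_rev w x]
  linarith

/-- The growth at `x` is tested at the proximal point of `y`. Its term `L / 2 * ‖w' - w‖²` absorbs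
the cross term by Young's inequality. -/
lemma IsProxPoint.le_moreau {x w : EuclideanSpace ℝ (Fin d)} (hw : IsProxPoint F L x w)
    {y w' : EuclideanSpace ℝ (Fin d)} (hw' : IsProxPoint F L y w') (hL : 0 < L) :
    moreauEnvelope F (1 / (2 * L)) x + inner ℝ ((2 * L) • (x - w)) (y - x) - L * ‖y - x‖ ^ 2
      ≤ moreauEnvelope F (1 / (2 * L)) y := by
  have h1 := hw.growth w'
  rw [hw'.eq]
  have h2 : w' - y = (w' - x) - (y - x) := by abel
  have h3 : x - w = (w' - w) - (w' - x) := by abel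
  have h4 := abs_le.1 (abs_real_inner_le_norm (w' - w) (y - x))
  rw [real_inner_smul_left, h3, inner_sub_left, h2, norm_sub_sq_real (w' - x)]
  have h5 : 0 ≤ L / 2 * (‖w' - w‖ - 2 * ‖y - x‖) ^ 2 := by positivity
  have h6 := mul_le_mul_of_nonneg_left h4.2 hL.le
  linarith

lemma hasGradientAt_of_abs_sub_le_sq {E : Type*} [NormedAddCommGroup E] [InnerProductSpace ℝ E]
    [CompleteSpace E] {M : E → ℝ} {x v : E} {K : ℝ}
    (h : ∀ y, |M y - M x - inner ℝ v (y - x)| ≤ K * ‖y - x‖ ^ 2) : HasGradientAt M v x := by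
  rw [hasGradientAt_iff_isLittleO]
  have h1 : (fun y => M y - M x - inner ℝ v (y - x)) =O[nhds x] fun y => ‖y - x‖ ^ 2 :=
    Asymptotics.IsBigO.of_bound K (Filter.Eventually.of_forall fun y => by
      simpa using h y)
  refine h1.trans_isLittleO ?_
  have h2 := (Asymptotics.isLittleO_norm_pow_id (E' := E) one_lt_two).comp_tendsto
    (tendsto_sub_nhds_zero_iff.2 (Filter.tendsto_id (x := nhds x)))
  simpa [Function.comp_def] using h2

lemma IsProxPoint.hasGradientAt_moreau (hL : 0 < L) (hl : 0 ≤ l)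
    (hF : ∀ x y, |F x - F y| ≤ l * ‖x - y‖) (hwc : IsWeaklyConvex F L)
    {x w : EuclideanSpace ℝ (Fin d)} (hw : IsProxPoint F L x w) :
    HasGradientAt (moreauEnvelope F (1 / (2 * L))) ((2 * L) • (x - w)) x := by
  refine hasGradientAt_of_abs_sub_le_sq (K := L) fun y => ?_
  obtain ⟨w', hw'⟩ := exists_isProxPoint hL hl hF hwc y
  rw [abs_le]
  constructor
  · linarith [hw.le_moreau hw' hL]
  · linarith [hw.moreau_le hw' hL]

lemma differentiable_moreau (hL : 0 < L) (hl : 0 ≤ l)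
    (hF : ∀ x y, |F x - F y| ≤ l * ‖x - y‖) (hwc : IsWeaklyConvex F L) :
    Differentiable ℝ (moreauEnvelope F (1 / (2 * L))) := fun x => by
  obtain ⟨w, hw⟩ := exists_isProxPoint hL hl hF hwc x
  exact (hw.hasGradientAt_moreau hL hl hF hwc).differentiableAt

lemma moreau_le_add_inner_gradient (hL : 0 < L) (hl : 0 ≤ l)
    (hF : ∀ x y, |F x - F y| ≤ l * ‖x - y‖) (hwc : IsWeaklyConvex F L)
    (x y : EuclideanSpace ℝ (Fin d)) :
    moreauEnvelope F (1 / (2 * L)) y ≤ moreauEnvelope F (1 / (2 * L)) x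
      + inner ℝ (gradient (moreauEnvelope F (1 / (2 * L))) x) (y - x) + L * ‖y - x‖ ^ 2 := by
  obtain ⟨w, hw⟩ := exists_isProxPoint hL hl hF hwc x
  obtain ⟨w', hw'⟩ := exists_isProxPoint hL hl hF hwc y
  rw [(hw.hasGradientAt_moreau hL hl hF hwc).gradient]
  exact hw.moreau_le hw' hL

/-- Growth at `x` bounds `L * ‖x - w‖²` by `F x - F w`. The uniform bound makes the gradient along
the run square integrable and lets it be paired with the noise. -/
lemma norm_gradient_moreau_le (hL : 0 < L) (hl : 0 ≤ l)
    (hF : ∀ x y, |F x - F y| ≤ l * ‖x - y‖) (hwc : IsWeaklyConvex F L)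
    (x : EuclideanSpace ℝ (Fin d)) :
    ‖gradient (moreauEnvelope F (1 / (2 * L))) x‖ ≤ 2 * l := by
  obtain ⟨w, hw⟩ := exists_isProxPoint hL hl hF hwc x
  rw [(hw.hasGradientAt_moreau hL hl hF hwc).gradient, norm_smul,
    Real.norm_of_nonneg (by positivity)]
  have h1 := hw.growth x
  have h2 := (abs_le.1 (hF x w)).2
  rw [hw.eq, norm_sub_rev w x, sub_self, norm_zero] at h1
  rcases (norm_nonneg (x - w)).eq_or_lt with h0 | h0
  · rw [← h0]; simpa using hl
  · have : (L * ‖x - w‖) * ‖x - w‖ ≤ l * ‖x - w‖ := by nlinarith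
    linarith [le_of_mul_le_mul_right this h0]

lemma moreau_bddBelow (hL : 0 < L) (hl : 0 ≤ l)
    (hF : ∀ x y, |F x - F y| ≤ l * ‖x - y‖) (hwc : IsWeaklyConvex F L)
    (hb : BddBelow (Set.range F)) :
    BddBelow (Set.range (moreauEnvelope F (1 / (2 * L)))) := by
  obtain ⟨c, hc⟩ := hb
  refine ⟨c, Set.forall_mem_range.2 fun x => ?_⟩
  obtain ⟨w, hw⟩ := exists_isProxPoint hL hl hF hwc x
  rw [hw.eq]
  have := hc (Set.mem_range_self w)
  have : 0 ≤ L * ‖w - x‖ ^ 2 := by positivity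
  linarith

/-- The gradient of the Moreau envelope is aligned with the gradient at `x` of any smooth
minorant of `F`, up to the gap at `x`. -/
lemma norm_sq_gradient_moreau_le (hL : 0 < L) (hl : 0 ≤ l)
    (hF : ∀ x y, |F x - F y| ≤ l * ‖x - y‖) (hwc : IsWeaklyConvex F L)
    {φ : EuclideanSpace ℝ (Fin d) → ℝ} (hd : Differentiable ℝ φ)
    (hs : ∀ x y, ‖gradient φ x - gradient φ y‖ ≤ L * ‖x - y‖) (hφ : ∀ x, φ x ≤ F x)
    (x : EuclideanSpace ℝ (Fin d)) :
    ‖gradient (moreauEnvelope F (1 / (2 * L))) x‖ ^ 2 ≤ 4 * L * (F x - φ x)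
      + 2 * inner ℝ (gradient (moreauEnvelope F (1 / (2 * L))) x) (gradient φ x) := by
  obtain ⟨w, hw⟩ := exists_isProxPoint hL hl hF hwc x
  rw [(hw.hasGradientAt_moreau hL hl hF hwc).gradient, norm_smul,
    Real.norm_of_nonneg (by positivity), real_inner_smul_left]
  have h1 := hw.growth x
  have h2 := add_inner_gradient_sub_le hd hs x w
  have h3 := hφ w
  rw [hw.eq, norm_sub_rev w x, sub_self, norm_zero] at h1
  rw [← neg_sub x w, norm_neg, inner_neg_right, real_inner_comm] at h2
  -- Growth at `x` provides `3L / 2`, and the smoothness of `φ` costs `L / 2`.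
  have h4 : L * ‖x - w‖ ^ 2 ≤ F x - φ x + inner ℝ (x - w) (gradient φ x) := by linarith
  nlinarith

end Moreau

/-! ### The primal function and its near-maximizers -/

section Primal

variable {d n : ℕ} {f : EuclideanSpace ℝ (Fin d) → (Fin n → ℝ) → ℝ} {h : (Fin n → ℝ) → ℝ}
  {L l : ℝ}

lemma le_primal (hΦ : IsRegularObjective f h L l) (x : EuclideanSpace ℝ (Fin d))
    {p : Fin n → ℝ} (hp : p ∈ stdSimplex ℝ (Fin n)) : f x p + h p ≤ primal f h x :=
  le_csSup ((isCompact_stdSimplex (𝕜 := ℝ) (ι := Fin n)).bddAbove_image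
    ((hΦ.continuous_f x).add hΦ.continuous_h)) (Set.mem_image_of_mem _ hp)

lemma exists_primal_eq (hΦ : IsRegularObjective f h L l) (hne : (stdSimplex ℝ (Fin n)).Nonempty)
    (x : EuclideanSpace ℝ (Fin d)) :
    ∃ p ∈ stdSimplex ℝ (Fin n), primal f h x = f x p + h p := by
  obtain ⟨p, hp, he⟩ := (isCompact_stdSimplex (𝕜 := ℝ) (ι := Fin n)).exists_sSup_image_eq hne
    ((hΦ.continuous_f x).add hΦ.continuous_h)
  exact ⟨p, hp, he⟩

lemma abs_primal_sub_le (hΦ : IsRegularObjective f h L l)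
    (hne : (stdSimplex ℝ (Fin n)).Nonempty) (x y : EuclideanSpace ℝ (Fin d)) :
    |primal f h x - primal f h y| ≤ l * ‖x - y‖ := by
  obtain ⟨p, hp, hpe⟩ := exists_primal_eq hΦ hne x
  obtain ⟨q, hq, hqe⟩ := exists_primal_eq hΦ hne y
  have h1 := le_primal hΦ x hq
  have h2 := le_primal hΦ y hp
  have h3 := abs_le.1 (hΦ.lipschitz p hp x y)
  have h4 := abs_le.1 (hΦ.lipschitz q hq x y)
  rw [abs_le]
  constructor <;> linarith

lemma isWeaklyConvex_primal (hΦ : IsRegularObjective f h L l)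
    (hne : (stdSimplex ℝ (Fin n)).Nonempty) : IsWeaklyConvex (primal f h) L := by
  intro a b e he he1
  obtain ⟨p, hp, hpe⟩ := exists_primal_eq hΦ hne ((1 - e) • a + e • b)
  have h1 := isWeaklyConvex_of_lipschitz_gradient (hΦ.differentiable p hp) (hΦ.smooth p hp)
    a b e he he1
  have h2 := mul_le_mul_of_nonneg_left (le_primal hΦ a hp) (by linarith : 0 ≤ 1 - e)
  have h3 := mul_le_mul_of_nonneg_left (le_primal hΦ b hp) he.le
  rw [hpe]
  linarith

lemma continuous_of_abs_sub_le {E : Type*} [NormedAddCommGroup E] {F : E → ℝ}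
    (hF : ∀ x y, |F x - F y| ≤ l * ‖x - y‖) : Continuous F := by
  have : LipschitzWith l.toNNReal F := LipschitzWith.of_dist_le_mul fun x y => by
    rw [Real.dist_eq, dist_eq_norm]
    exact (hF x y).trans (by gcongr; exact Real.le_coe_toNNReal l)
  exact this.continuous

/-- Measurable selection of `δ`-optimal dual points. -/
lemma exists_measurable_nearly_optimal (hΦ : IsRegularObjective f h L l)
    (hne : (stdSimplex ℝ (Fin n)).Nonempty) {δ : ℝ} (hδ : 0 < δ) :
    ∃ s : EuclideanSpace ℝ (Fin d) → Fin n → ℝ, Measurable s ∧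
      ∀ x, s x ∈ stdSimplex ℝ (Fin n) ∧ primal f h x ≤ f x (s x) + h (s x) + δ := by
  classical
  have : Nonempty (stdSimplex ℝ (Fin n)) := hne.to_subtype
  -- Taking the first `δ`-optimal point of a dense sequence reduces measurability to countably many
  -- closed conditions on `x`; the slack `δ` guarantees that such a point exists.
  set u : ℕ → stdSimplex ℝ (Fin n) := TopologicalSpace.denseSeq _
  have hex : ∀ x, ∃ k, primal f h x ≤ f x (u k) + h (u k) + δ := by
    intro x
    have hc : Continuous fun p : stdSimplex ℝ (Fin n) => f x p + h p :=
      continuousOn_iff_continuous_domRestrict.1 ((hΦ.continuous_f x).add hΦ.continuous_h)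
    obtain ⟨p, hp, hpe⟩ := exists_primal_eq hΦ hne x
    obtain ⟨k, hq⟩ := (TopologicalSpace.denseRange_denseSeq
      (stdSimplex ℝ (Fin n))).exists_mem_open
      (isOpen_lt (continuous_const (y := primal f h x - δ)) hc)
      ⟨⟨p, hp⟩, show primal f h x - δ < f x p + h p by linarith⟩
    replace hq : primal f h x - δ < f x (u k) + h (u k) := hq
    exact ⟨k, by linarith⟩
  refine ⟨fun x => u (Nat.find (hex x)), ?_, fun x => ⟨(u _).2, Nat.find_spec (hex x)⟩⟩
  have hm : Measurable fun x => Nat.find (hex x) := by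
    refine measurable_find hex fun k => ?_
    refine (isClosed_le (continuous_of_abs_sub_le (abs_primal_sub_le hΦ hne)) ?_).measurableSet
    exact ((hΦ.differentiable _ (u k).2).continuous).add_const δ
  exact (measurable_from_nat (f := fun k => ((u k : stdSimplex ℝ (Fin n)) : Fin n → ℝ))).comp hm

lemma gradient_add_const {E : Type*} [NormedAddCommGroup E] [InnerProductSpace ℝ E]
    [CompleteSpace E] (φ : E → ℝ) (c : ℝ) : gradient (fun x => φ x + c) = gradient φ := by
  ext1 x
  simp [gradient, fderiv_add_const]

/-- The supergradient inequality on the simplex. -/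
lemma HasSimplexGradientAt.sub_le {φ : (Fin n → ℝ) → ℝ} {v p q : Fin n → ℝ}
    (hv : HasSimplexGradientAt φ v p) (hφ : ConcaveOn ℝ (stdSimplex ℝ (Fin n)) φ)
    (hp : p ∈ stdSimplex ℝ (Fin n)) (hq : q ∈ stdSimplex ℝ (Fin n)) :
    φ q - φ p ≤ ∑ i, v i * (q i - p i) := by
  have hline : HasDerivWithinAt (fun s : ℝ => p + s • (q - p)) (q - p) (Set.Icc 0 1) 0 := by
    have := ((hasDerivAt_id (0 : ℝ)).smul_const (q - p)).const_add p
    simpa using this.hasDerivWithinAt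
  have hmaps : Set.MapsTo (fun s : ℝ => p + s • (q - p)) (Set.Icc 0 1) (stdSimplex ℝ (Fin n)) := by
    intro s hs
    exact (convex_stdSimplex ℝ (Fin n)).add_smul_sub_mem hp hq hs
  have hv' : HasSimplexGradientAt φ v (p + (0 : ℝ) • (q - p)) := by
    rw [zero_smul, add_zero]; exact hv
  unfold HasSimplexGradientAt at hv'
  have hd := HasFDerivWithinAt.comp_hasDerivWithinAt (f := fun s : ℝ => p + s • (q - p)) (0 : ℝ)
    hv' hline hmaps
  have hval : (∑ i, v i • ContinuousLinearMap.proj (R := ℝ) (φ := fun _ : Fin n => ℝ) i) (q - p)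
      = ∑ i, v i * (q i - p i) := by
    simp
  rw [hval] at hd
  have ht := (hasDerivWithinAt_iff_tendsto_slope.1 hd)
  have hIcc : Set.Icc (0 : ℝ) 1 \ {0} = Set.Ioc 0 1 := Set.Icc_sdiff_left
  rw [hIcc, nhdsWithin_Ioc_eq_nhdsGT zero_lt_one] at ht
  refine ge_of_tendsto ht ?_
  filter_upwards [Ioo_mem_nhdsGT (zero_lt_one (α := ℝ))] with s hs
  have h1 := hφ.2 hp hq (by linarith [hs.2] : 0 ≤ 1 - s) hs.1.le (by ring)
  have h2 : (1 - s) • p + s • q = p + s • (q - p) := by module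
  rw [h2, smul_eq_mul, smul_eq_mul] at h1
  rw [slope_def_field, le_div_iff₀ (by linarith [hs.1])]
  simp only [Function.comp, zero_smul, add_zero, sub_zero]
  linarith

end Primal

/-! ### Pathwise estimates over blocks -/

section Pathwise

variable {d n : ℕ} {f : EuclideanSpace ℝ (Fin d) → (Fin n → ℝ) → ℝ} {h : (Fin n → ℝ) → ℝ}
  {L l : ℝ}

/-- Each block costs `c` and `b` telescopes. The block bound is required for every `e` up to the
block's end because the last block may be truncated. -/
lemma sum_range_le_of_blocks {a b : ℕ → ℝ} {B T : ℕ} {c : ℝ} (hc : 0 ≤ c)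
    (hblock : ∀ j e, j * B ≤ e → e ≤ (j + 1) * B → e ≤ T →
      ∑ t ∈ Finset.Ico (j * B) e, a t ≤ c + b e - b (j * B))
    (N e : ℕ) (he : e ≤ N * B) (heT : e ≤ T) :
    ∑ t ∈ Finset.range e, a t ≤ N * c + b e - b 0 := by
  induction N generalizing e with
  | zero =>
    obtain rfl : e = 0 := by simpa using he
    simp
  | succ N ih =>
    push_cast
    rcases le_total e (N * B) with h1 | h1
    · linarith [ih e h1 heT]
    · rw [← Finset.sum_range_add_sum_Ico _ h1]
      linarith [ih (N * B) le_rfl (h1.trans heT), hblock N e h1 he heT]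

/-- The mean position inside a block is at most `(B - 1) / 2`, and truncating the last block only
lowers it. It bounds the total drift. -/
lemma two_mul_sum_mod_le {B : ℕ} (e : ℕ) (hB : 0 < B) :
    2 * ∑ t ∈ Finset.range e, ((t % B : ℕ) : ℝ) ≤ e * (B - 1 : ℝ) := by
  rw [Finset.mul_sum]
  have := sum_range_le_of_blocks (a := fun t => 2 * ((t % B : ℕ) : ℝ))
    (b := fun e => e * (B - 1 : ℝ)) (B := B) (T := e) (c := 0) le_rfl ?_ e e
    (Nat.le_mul_of_pos_right e hB) le_rfl
  · simpa using this
  · intro j e' h1 h2 _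
    obtain ⟨m, rfl⟩ := Nat.exists_eq_add_of_le h1
    have hm : m ≤ B := by rw [add_mul, one_mul] at h2; omega
    rw [Finset.sum_Ico_eq_sum_range, Nat.add_sub_cancel_left]
    have h3 : ∑ k ∈ Finset.range m, 2 * (((j * B + k) % B : ℕ) : ℝ)
        = ∑ k ∈ Finset.range m, 2 * (k : ℝ) := by
      refine Finset.sum_congr rfl fun k hk => ?_
      have hk' : k < B := (Finset.mem_range.1 hk).trans_le hm
      rw [Nat.mul_comm j B, Nat.mul_add_mod, Nat.mod_eq_of_lt hk']
    have h4 : ∀ m : ℕ, ∑ k ∈ Finset.range m, 2 * (k : ℝ) = m * (m - 1) := by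
      intro m
      induction m with
      | zero => simp
      | succ m ih => rw [Finset.sum_range_succ, ih]; push_cast; ring
    rw [h3, h4]
    push_cast
    have h5 : (m : ℝ) * (m - 1) ≤ m * (B - 1) := by
      have : (m : ℝ) ≤ B := by exact_mod_cast hm
      gcongr
    linarith

/-- Regret of proximal mirror ascent over consecutive steps against a fixed comparator. -/
lemma mirror_regret_le {lam K : ℝ} {p γ : ℕ → Fin n → ℝ} {q : Fin n → ℝ} {s e : ℕ}
    (hh : ConcaveOn ℝ (stdSimplex ℝ (Fin n)) h) (hlam : 0 < lam) (hK : 0 ≤ K)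
    (hstep : ∀ t, s ≤ t → t < e → IsMirrorStep h lam (γ t) (p t) (p (t + 1)))
    (hp : ∀ t, s ≤ t → t < e → p t ∈ stdSimplex ℝ (Fin n))
    (hpos : ∀ t, s ≤ t → t < e → ∀ i, 0 < p t i)
    (hq : q ∈ stdSimplex ℝ (Fin n)) (hKs : s < e → klSum q (p s) ≤ K) (hse : s ≤ e) :
    ∑ t ∈ Finset.Ico s e, (h q - h (p t) + ∑ i, γ t i * (q i - p t i) - lam * ‖γ t‖ ^ 2)
      ≤ 1 / (2 * lam) * K + h (p e) - h (p s) := by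
  -- The telescoping form needs the next iterate to be positive, which is known only before time
  -- `e`. The last step therefore uses `step_le`, whose divergence cancels the one left by the
  -- telescoped sum.
  have hstrong : ∀ e', s ≤ e' → e' < e →
      ∑ t ∈ Finset.Ico s e', (h q - h (p t) + ∑ i, γ t i * (q i - p t i) - lam * ‖γ t‖ ^ 2)
        ≤ 1 / (2 * lam) * (klSum q (p s) - klSum q (p e')) + h (p e') - h (p s) := by
    intro e' he'
    induction e', he' using Nat.le_induction with
    | base => simp
    | succ e' he' ih =>
      intro hlt
      rw [Finset.sum_Ico_succ_top he']
      have h1 := ih (by omega)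
      have h2 := (hstep e' he' (by omega)).step_le_sub hh hlam (hp e' he' (by omega))
        (hpos e' he' (by omega)) (hpos (e' + 1) (by omega) hlt) hq
      generalize 1 / (2 * lam) = c at *
      linear_combination h1 + h2
  rcases hse.eq_or_lt with rfl | hlt
  · simp; positivity
  obtain ⟨e', rfl⟩ : ∃ e', e = e' + 1 := ⟨e - 1, by omega⟩
  have he' : s ≤ e' := by omega
  rw [Finset.sum_Ico_succ_top he']
  have h1 := hstrong e' he' (by omega)
  have h2 := (hstep e' he' (by omega)).step_le hh hlam (hp e' he' (by omega))
    (hpos e' he' (by omega)) hq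
  have h3 : 1 / (2 * lam) * klSum q (p s) ≤ 1 / (2 * lam) * K := by gcongr; exact hKs hlt
  generalize 1 / (2 * lam) = c at *
  linear_combination h1 + h2 + h3

/-- The distance is paid twice: once for `primal f h` and once for `f · q`. The rest is the
supergradient inequality at `x`. -/
lemma primal_sub_le {δ : ℝ} (hΦ : IsRegularObjective f h L l)
    (hne : (stdSimplex ℝ (Fin n)).Nonempty) {x y : EuclideanSpace ℝ (Fin d)}
    {p q v : Fin n → ℝ} (hp : p ∈ stdSimplex ℝ (Fin n)) (hq : q ∈ stdSimplex ℝ (Fin n))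
    (hqy : primal f h y ≤ f y q + h q + δ) (hv : HasSimplexGradientAt (f x) v p) :
    primal f h x - (f x p + h p)
      ≤ δ + 2 * l * ‖x - y‖ + ∑ i, v i * (q i - p i) + (h q - h p) := by
  have h1 := (abs_le.1 (abs_primal_sub_le hΦ hne x y)).2
  have h2 := (abs_le.1 (hΦ.lipschitz q hq x y)).1
  have h3 := hv.sub_le (hΦ.concave_f x) hp hq
  linarith

/-- Sum the quadratic upper bound of the envelope along the steps and divide by `η`. -/
lemma sum_inner_gradient_moreau_le {η : ℝ} {T : ℕ} {x g : ℕ → EuclideanSpace ℝ (Fin d)}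
    {F : EuclideanSpace ℝ (Fin d) → ℝ} (hL : 0 < L) (hl : 0 ≤ l)
    (hF : ∀ x y, |F x - F y| ≤ l * ‖x - y‖) (hwc : IsWeaklyConvex F L)
    (hb : BddBelow (Set.range F)) (hη : 0 < η)
    (hx : ∀ t < T, x (t + 1) = x t - η • g t) :
    ∑ t ∈ Finset.range T, 2 * inner ℝ (gradient (moreauEnvelope F (1 / (2 * L))) (x t)) (g t)
      ≤ 2 * (moreauEnvelope F (1 / (2 * L)) (x 0) - ⨅ y, moreauEnvelope F (1 / (2 * L)) y) / η
        + ∑ t ∈ Finset.range T, 2 * L * η * ‖g t‖ ^ 2 := by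
  set M := moreauEnvelope F (1 / (2 * L)) with hM
  have hstep : ∀ t < T, η * inner ℝ (gradient M (x t)) (g t) - L * η ^ 2 * ‖g t‖ ^ 2
      ≤ M (x t) - M (x (t + 1)) := by
    intro t ht
    have h1 := moreau_le_add_inner_gradient hL hl hF hwc (x t) (x (t + 1))
    rw [hx t ht, sub_sub_cancel_left, inner_neg_right, inner_smul_right, norm_neg, norm_smul,
      mul_pow, Real.norm_eq_abs, sq_abs, ← hM] at h1
    rw [hx t ht]
    linarith
  have hsum := Finset.sum_le_sum fun t ht => hstep t (Finset.mem_range.1 ht)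
  rw [Finset.sum_range_sub'] at hsum
  have hinf : ⨅ y, M y ≤ M (x T) := ciInf_le (moreau_bddBelow hL hl hF hwc hb) _
  rw [Finset.sum_sub_distrib, ← Finset.mul_sum, ← Finset.mul_sum] at hsum
  rw [← Finset.mul_sum, ← Finset.mul_sum, ← sub_le_iff_le_add, le_div_iff₀ hη]
  linear_combination 2 * hsum + 2 * hinf

/-- Pathwise bound on the squared gradients of the Moreau envelope along a run, with comparators
`sel (x (t - t % B))` that are frozen over blocks of length `B`. -/
lemma sum_norm_sq_gradient_moreau_le {η lam K δ : ℝ} {T B N : ℕ}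
    {x g : ℕ → EuclideanSpace ℝ (Fin d)} {p γ v : ℕ → Fin n → ℝ}
    {sel : EuclideanSpace ℝ (Fin d) → Fin n → ℝ}
    (hL : 0 < L) (hl : 0 ≤ l) (hΦ : IsRegularObjective f h L l)
    (hne : (stdSimplex ℝ (Fin n)).Nonempty) (hb : BddBelow (Set.range (primal f h)))
    (hη : 0 < η) (hlam : 0 < lam) (hK : 0 ≤ K)
    (hx : ∀ t < T, x (t + 1) = x t - η • g t)
    (hstep : ∀ t < T, IsMirrorStep h lam (γ t) (p t) (p (t + 1)))
    (hp : ∀ t ≤ T, p t ∈ stdSimplex ℝ (Fin n))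
    (hpos : ∀ t < T, ∀ i, 0 < p t i)
    (hKt : ∀ t < T, ∀ q ∈ stdSimplex ℝ (Fin n), klSum q (p t) ≤ K)
    (hv : ∀ t < T, HasSimplexGradientAt (f (x t)) (v t) (p t))
    (hsel : ∀ y, sel y ∈ stdSimplex ℝ (Fin n) ∧ primal f h y ≤ f y (sel y) + h (sel y) + δ)
    (hTN : T ≤ N * B) :
    ∑ t ∈ Finset.range T, ‖gradient (moreauEnvelope (primal f h) (1 / (2 * L))) (x t)‖ ^ 2
      ≤ 2 * (moreauEnvelope (primal f h) (1 / (2 * L)) (x 0)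
          - ⨅ y, moreauEnvelope (primal f h) (1 / (2 * L)) y) / η
        + 4 * L * (N * (1 / (2 * lam) * K)
          + (sSup (h '' stdSimplex ℝ (Fin n)) - h (p 0)) + T * δ)
        + ∑ t ∈ Finset.range T,
          (2 * inner ℝ (gradient (moreauEnvelope (primal f h) (1 / (2 * L))) (x t))
              (gradient (fun y => f y (p t)) (x t) - g t)
            + 2 * L * η * ‖g t‖ ^ 2
            + 4 * L * (2 * l * ‖x t - x (t - t % B)‖
              + ∑ i, (sel (x (t - t % B)) i - p t i) * (v t i - γ t i)
              + lam * ‖γ t‖ ^ 2)) := by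
  have hF := abs_primal_sub_le hΦ hne
  have hwc := isWeaklyConvex_primal hΦ hne
  have hmor := sum_inner_gradient_moreau_le hL hl hF hwc hb hη hx
  set M := moreauEnvelope (primal f h) (1 / (2 * L)) with hM
  set q : ℕ → Fin n → ℝ := fun t => sel (x (t - t % B)) with hq
  have hmir := sum_range_le_of_blocks (B := B) (T := T) (b := fun t => h (p t))
    (a := fun t => h (q t) - h (p t) + ∑ i, γ t i * (q t i - p t i) - lam * ‖γ t‖ ^ 2)
    (c := 1 / (2 * lam) * K) (by positivity) ?_ N T hTN le_rfl
  · have hHT : h (p T) ≤ sSup (h '' stdSimplex ℝ (Fin n)) :=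
      le_csSup ((isCompact_stdSimplex (𝕜 := ℝ) (ι := Fin n)).bddAbove_image hΦ.continuous_h)
        (Set.mem_image_of_mem _ (hp T le_rfl))
    -- Stochastic gradients are added and subtracted: the regret and descent bounds apply to `γ` and
    -- `g`, and the differences from the true gradients stay as noise.
    have hpt : ∀ t ∈ Finset.range T, ‖gradient M (x t)‖ ^ 2 ≤
        4 * L * δ + 4 * L * (h (q t) - h (p t) + ∑ i, γ t i * (q t i - p t i) - lam * ‖γ t‖ ^ 2)
        + (2 * inner ℝ (gradient M (x t)) (g t) - 2 * L * η * ‖g t‖ ^ 2)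
        + (2 * inner ℝ (gradient M (x t)) (gradient (fun y => f y (p t)) (x t) - g t)
            + 2 * L * η * ‖g t‖ ^ 2
            + 4 * L * (2 * l * ‖x t - x (t - t % B)‖
              + ∑ i, (q t i - p t i) * (v t i - γ t i)
              + lam * ‖γ t‖ ^ 2)) := by
      intro t ht
      have ht := Finset.mem_range.1 ht
      have h1 := norm_sq_gradient_moreau_le hL hl hF hwc (hΦ.differentiable _ (hp t ht.le))
        (hΦ.smooth _ (hp t ht.le)) (fun y => le_primal hΦ y (hp t ht.le)) (x t)
      have h2 := primal_sub_le hΦ hne (hp t ht.le) (hsel (x (t - t % B))).1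
        (hsel (x (t - t % B))).2 (hv t ht)
      rw [gradient_add_const, ← hM] at h1
      have h3 : ∑ i, (q t i - p t i) * (v t i - γ t i)
          = ∑ i, v t i * (q t i - p t i) - ∑ i, γ t i * (q t i - p t i) := by
        rw [← Finset.sum_sub_distrib]
        exact Finset.sum_congr rfl fun i _ => by ring
      rw [h3, inner_sub_right]
      change _ ≤ δ + _ + ∑ i, v t i * (q t i - p t i) + (h (q t) - h (p t)) at h2
      have h4 := mul_le_mul_of_nonneg_left h2 (by positivity : 0 ≤ 4 * L)
      linear_combination h1 + h4
    refine (Finset.sum_le_sum hpt).trans ?_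
    rw [Finset.sum_add_distrib, Finset.sum_add_distrib, Finset.sum_add_distrib,
      Finset.sum_sub_distrib, Finset.sum_const, Finset.card_range, nsmul_eq_mul, ← Finset.mul_sum]
    have h4 := mul_le_mul_of_nonneg_left (hmir.trans (sub_le_sub_right
      (add_le_add_right hHT _) _)) (by positivity : 0 ≤ 4 * L)
    linear_combination h4 + hmor
  · intro j e h1 h2 h3
    have hqj : ∀ t ∈ Finset.Ico (j * B) e, q t = q (j * B) := by
      intro t ht
      rw [Finset.mem_Ico] at ht
      obtain ⟨m, rfl⟩ := Nat.exists_eq_add_of_le ht.1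
      have hm : m < B := by rw [add_mul, one_mul] at h2; omega
      have hmod : (j * B + m) % B = m := by
        rw [Nat.mul_comm j B, Nat.mul_add_mod, Nat.mod_eq_of_lt hm]
      simp only [hq, hmod, Nat.add_sub_cancel, Nat.mul_mod_left, Nat.sub_zero]
    rw [Finset.sum_congr rfl fun t ht => by rw [hqj t ht]]
    exact mirror_regret_le hΦ.concave_h hlam hK (fun t _ ht => hstep t (ht.trans_le h3))
      (fun t _ ht => hp t (ht.trans_le h3).le) (fun t _ ht => hpos t (ht.trans_le h3))
      (hsel _).1 (fun hlt => hKt _ (hlt.trans_le h3) _ (hsel _).1) h1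

end Pathwise

/-! ### Conditional expectation, second moments and drift -/

section Probability

variable {Ω : Type*} {mΩ : MeasurableSpace Ω} {μ : Measure Ω} [IsProbabilityMeasure μ]

/-- A bounded `m`-measurable direction does not see the noise `μ[g|m] - g`. -/
lemma integral_bilin_condExp_sub_eq_zero {E F : Type*} [NormedAddCommGroup E] [NormedSpace ℝ E]
    [CompleteSpace E] [NormedAddCommGroup F] [NormedSpace ℝ F] (B : F →L[ℝ] E →L[ℝ] ℝ)
    {m : MeasurableSpace Ω} (hm : m ≤ mΩ) {X : Ω → F} {g : Ω → E} {c : ℝ}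
    (hX : StronglyMeasurable[m] X) (hc : ∀ᵐ ω ∂μ, ‖X ω‖ ≤ c) (hg : Integrable g μ) :
    ∫ ω, B (X ω) ((μ[g | m]) ω - g ω) ∂μ = 0 := by
  have hX' := (hX.mono hm).aestronglyMeasurable (μ := μ)
  simp only [map_sub]
  rw [integral_sub (B.integrable_of_bilin_of_bdd_left c hX' hc integrable_condExp)
    (B.integrable_of_bilin_of_bdd_left c hX' hc hg), sub_eq_zero,
    ← integral_congr_ae (condExp_stronglyMeasurable_bilin_of_bound B hm hX hg c hc),
    integral_condExp hm]

/-- The coordinatewise product `∑ i, a i * b i` as a continuous bilinear map. -/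
noncomputable def dotBilin (n : ℕ) : (Fin n → ℝ) →L[ℝ] (Fin n → ℝ) →L[ℝ] ℝ :=
  ∑ i, (ContinuousLinearMap.mul ℝ ℝ).bilinearComp
    (ContinuousLinearMap.proj (R := ℝ) (φ := fun _ : Fin n => ℝ) i)
    (ContinuousLinearMap.proj (R := ℝ) (φ := fun _ : Fin n => ℝ) i)

lemma dotBilin_apply {n : ℕ} (a b : Fin n → ℝ) : dotBilin n a b = ∑ i, a i * b i := by
  simp [dotBilin]

/-- Pythagoras: the noise is orthogonal in `L²` to the conditional mean. -/
lemma integral_norm_sq_le_of_condExp_bound {E : Type*} [NormedAddCommGroup E]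
    [InnerProductSpace ℝ E] [CompleteSpace E] {m : MeasurableSpace Ω} (hm : m ≤ mΩ)
    {g : Ω → E} {l σ : ℝ} (hg : MemLp g 2 μ)
    (hu : ∀ᵐ ω ∂μ, ‖(μ[g | m]) ω‖ ≤ l)
    (hσ : ∫ ω, ‖g ω - (μ[g | m]) ω‖ ^ 2 ∂μ ≤ σ ^ 2) :
    ∫ ω, ‖g ω‖ ^ 2 ∂μ ≤ l ^ 2 + σ ^ 2 := by
  have hgi : Integrable g μ := hg.integrable one_le_two
  have hum : StronglyMeasurable[m] (μ[g | m]) := stronglyMeasurable_condExp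
  have hum' := (hum.mono hm).aestronglyMeasurable (μ := μ)
  have hu2 : MemLp (μ[g | m]) 2 μ := MemLp.of_bound hum' l hu
  have h0 : ∫ ω, inner ℝ ((μ[g | m]) ω) ((μ[g | m]) ω - g ω) ∂μ = 0 :=
    integral_bilin_condExp_sub_eq_zero (innerSL ℝ) hm hum hu hgi
  have hi0 : Integrable (fun ω => inner ℝ ((μ[g | m]) ω) ((μ[g | m]) ω - g ω)) μ :=
    ContinuousLinearMap.integrable_of_bilin_of_bdd_left (innerSL ℝ) l hum' hu
      (integrable_condExp.sub hgi)
  have hi1 : Integrable (fun ω => ‖g ω - (μ[g | m]) ω‖ ^ 2) μ :=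
    (hg.sub hu2).integrable_norm_pow two_ne_zero
  have hi2 : Integrable (fun ω => ‖(μ[g | m]) ω‖ ^ 2) μ := hu2.integrable_norm_pow two_ne_zero
  have heq : ∀ ω, ‖g ω‖ ^ 2 = ‖(μ[g | m]) ω‖ ^ 2 + ‖g ω - (μ[g | m]) ω‖ ^ 2
      - 2 * inner ℝ ((μ[g | m]) ω) ((μ[g | m]) ω - g ω) := by
    intro ω
    rw [norm_sub_sq_real, inner_sub_right, real_inner_self_eq_norm_sq,
      real_inner_comm]
    ring
  have hi12 : Integrable (fun ω => ‖(μ[g | m]) ω‖ ^ 2 + ‖g ω - (μ[g | m]) ω‖ ^ 2) μ := hi2.add hi1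
  rw [integral_congr_ae (Filter.Eventually.of_forall heq), integral_sub hi12 (hi0.const_mul 2), integral_const_mul, h0,
    integral_add hi2 hi1]
  have : ∫ ω, ‖(μ[g | m]) ω‖ ^ 2 ∂μ ≤ ∫ _, l ^ 2 ∂μ := by
    refine integral_mono_ae hi2 (integrable_const _) ?_
    filter_upwards [hu] with ω hω
    gcongr
  rw [integral_const, probReal_univ, one_smul] at this
  linarith

lemma integral_norm_le_sqrt {E : Type*} [NormedAddCommGroup E] {g : Ω → E} {c : ℝ}
    (hg : MemLp g 2 μ) (h : ∫ ω, ‖g ω‖ ^ 2 ∂μ ≤ c) : ∫ ω, ‖g ω‖ ∂μ ≤ Real.sqrt c := by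
  apply Real.le_sqrt_of_sq_le
  refine le_trans ?_ h
  have h1 := variance_nonneg (fun ω => ‖g ω‖) μ
  rw [variance_eq_sub hg.norm] at h1
  simpa using h1

lemma measurable_gradient {E : Type*} [NormedAddCommGroup E] [InnerProductSpace ℝ E]
    [CompleteSpace E] [MeasurableSpace E] [BorelSpace E] (φ : E → ℝ) :
    Measurable (gradient φ) :=
  (InnerProductSpace.toDual ℝ E).symm.continuous.measurable.comp (measurable_fderiv ℝ φ)

lemma integrable_norm_sub_and_integral_le {E : Type*} [NormedAddCommGroup E] [NormedSpace ℝ E]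
    {x g : ℕ → Ω → E} {η S : ℝ} {T : ℕ} (hη : 0 ≤ η)
    (hx : ∀ t < T, ∀ᵐ ω ∂μ, x (t + 1) ω = x t ω - η • g t ω)
    (hg : ∀ t < T, Integrable (g t) μ) (hS : ∀ t < T, ∫ ω, ‖g t ω‖ ∂μ ≤ S) (s k : ℕ)
    (hk : s + k ≤ T) :
    Integrable (fun ω => x (s + k) ω - x s ω) μ ∧
      ∫ ω, ‖x (s + k) ω - x s ω‖ ∂μ ≤ η * k * S := by
  induction k with
  | zero => simp
  | succ k ih =>
    obtain ⟨h1, h2⟩ := ih (by omega)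
    have ht : s + k < T := by omega
    have heq : (fun ω => x (s + (k + 1)) ω - x s ω)
        =ᵐ[μ] fun ω => (x (s + k) ω - x s ω) - η • g (s + k) ω := by
      filter_upwards [hx (s + k) ht] with ω hω
      rw [← add_assoc, hω]
      abel
    have hgi := (hg _ ht).smul η
    refine ⟨(h1.sub hgi).congr heq.symm, ?_⟩
    calc ∫ ω, ‖x (s + (k + 1)) ω - x s ω‖ ∂μ
        = ∫ ω, ‖(x (s + k) ω - x s ω) - η • g (s + k) ω‖ ∂μ :=
          integral_congr_ae (heq.fun_comp norm)
      _ ≤ ∫ ω, (‖x (s + k) ω - x s ω‖ + η * ‖g (s + k) ω‖) ∂μ := by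
          refine integral_mono (h1.sub hgi).norm (h1.norm.add ((hg _ ht).norm.const_mul η)) ?_
          intro ω
          refine (norm_sub_le _ _).trans (le_of_eq ?_)
          rw [norm_smul, Real.norm_of_nonneg hη]
      _ = ∫ ω, ‖x (s + k) ω - x s ω‖ ∂μ + η * ∫ ω, ‖g (s + k) ω‖ ∂μ := by
          rw [integral_add h1.norm ((hg _ ht).norm.const_mul η), integral_const_mul]
      _ ≤ η * k * S + η * S := by gcongr; exact hS _ ht
      _ = η * (k + 1 : ℕ) * S := by push_cast; ring

omit [IsProbabilityMeasure μ] in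
lemma integral_linearCombination {a₁ a₂ a₃ a₄ a₅ : Ω → ℝ} (h₁ : Integrable a₁ μ)
    (h₂ : Integrable a₂ μ) (h₃ : Integrable a₃ μ) (h₄ : Integrable a₄ μ) (h₅ : Integrable a₅ μ)
    (c₁ c₂ c c₃ c₅ : ℝ) :
    Integrable (fun ω => c₁ * a₁ ω + c₂ * a₂ ω + c * (c₃ * a₃ ω + a₄ ω + c₅ * a₅ ω)) μ ∧
      ∫ ω, (c₁ * a₁ ω + c₂ * a₂ ω + c * (c₃ * a₃ ω + a₄ ω + c₅ * a₅ ω)) ∂μ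
        = c₁ * ∫ ω, a₁ ω ∂μ + c₂ * ∫ ω, a₂ ω ∂μ
          + c * (c₃ * ∫ ω, a₃ ω ∂μ + ∫ ω, a₄ ω ∂μ + c₅ * ∫ ω, a₅ ω ∂μ) := by
  have h12 : Integrable (fun ω => c₁ * a₁ ω + c₂ * a₂ ω) μ :=
    (h₁.const_mul c₁).add (h₂.const_mul c₂)
  have h34 : Integrable (fun ω => c₃ * a₃ ω + a₄ ω) μ := (h₃.const_mul c₃).add h₄
  have h345 : Integrable (fun ω => c₃ * a₃ ω + a₄ ω + c₅ * a₅ ω) μ := h34.add (h₅.const_mul c₅)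
  refine ⟨h12.add (h345.const_mul c), ?_⟩
  rw [integral_add h12 (h345.const_mul c), integral_add (h₁.const_mul c₁) (h₂.const_mul c₂),
    integral_const_mul c, integral_add h34 (h₅.const_mul c₅), integral_add (h₃.const_mul c₃) h₄]
  simp only [integral_const_mul]

lemma norm_le_one_of_mem_stdSimplex {n : ℕ} {p : Fin n → ℝ} (hp : p ∈ stdSimplex ℝ (Fin n)) :
    ‖p‖ ≤ 1 := by
  rw [pi_norm_le_iff_of_nonneg zero_le_one]
  intro i
  rw [Real.norm_of_nonneg (hp.1 i), ← hp.2]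
  exact Finset.single_le_sum (fun j _ => hp.1 j) (Finset.mem_univ i)

end Probability

/-! ### Expected estimates along a run -/

section Run

variable {d n : ℕ} {Ω : Type*} {mΩ : MeasurableSpace Ω} {μ : Measure Ω} [IsProbabilityMeasure μ]
  {ℱ : Filtration ℕ mΩ} {f : EuclideanSpace ℝ (Fin d) → (Fin n → ℝ) → ℝ} {h : (Fin n → ℝ) → ℝ}
  {L l σ G η lam : ℝ} {T : ℕ} {θ₀ : EuclideanSpace ℝ (Fin d)} {π₀ : Fin n → ℝ}
  {θ gθ : ℕ → Ω → EuclideanSpace ℝ (Fin d)} {π gπ : ℕ → Ω → Fin n → ℝ}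

omit [IsProbabilityMeasure μ] in
lemma IsRun.mem_stdSimplex (hrun : IsRun μ ℱ h T η lam θ₀ π₀ θ gθ π gπ) {t : ℕ} (ht : t ≤ T) :
    ∀ᵐ ω ∂μ, π t ω ∈ stdSimplex ℝ (Fin n) := by
  cases t with
  | zero => exact Filter.Eventually.of_forall fun ω => by rw [hrun.init_π]; exact hrun.init_mem
  | succ t =>
    filter_upwards [hrun.step_π t ht] with ω hω using hω.1

lemma memLp_gradient_moreau (hL : 0 < L) (hl : 0 ≤ l)
    {F : EuclideanSpace ℝ (Fin d) → ℝ}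
    (hF : ∀ x y, |F x - F y| ≤ l * ‖x - y‖) (hwc : IsWeaklyConvex F L)
    {x : Ω → EuclideanSpace ℝ (Fin d)} (hx : Measurable x) :
    MemLp (fun ω => gradient (moreauEnvelope F (1 / (2 * L))) (x ω)) 2 μ :=
  MemLp.of_bound ((measurable_gradient _).comp hx).aestronglyMeasurable (2 * l)
    (Filter.Eventually.of_forall fun ω => norm_gradient_moreau_le hL hl hF hwc (x ω))

lemma IsUnbiasedOracle.integral_norm_sq_le (hl : 0 ≤ l) (hΦ : IsRegularObjective f h L l)
    (hrun : IsRun μ ℱ h T η lam θ₀ π₀ θ gθ π gπ)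
    (ho : IsUnbiasedOracle μ ℱ f T σ G θ gθ π gπ) {t : ℕ} (ht : t < T) :
    ∫ ω, ‖gθ t ω‖ ^ 2 ∂μ ≤ l ^ 2 + σ ^ 2 := by
  refine integral_norm_sq_le_of_condExp_bound (ℱ.le t) (ho.memLp_θ t ht) ?_ (ho.variance_θ t ht)
  filter_upwards [ho.unbiased_θ t ht, hrun.mem_stdSimplex ht.le] with ω h1 h2
  rw [h1, ← gradient_add_const _ (h (π t ω))]
  exact norm_gradient_le_of_lipschitz hl (hΦ.lipschitz _ h2) _

/-- Expected value of the error terms of a single step. -/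
lemma integrable_stepError_and_integral_le {B : ℕ}
    {sel : EuclideanSpace ℝ (Fin d) → Fin n → ℝ}
    (hL : 0 < L) (hl : 0 ≤ l) (hΦ : IsRegularObjective f h L l)
    (hne : (stdSimplex ℝ (Fin n)).Nonempty) (hη : 0 < η) (hlam : 0 < lam)
    (hrun : IsRun μ ℱ h T η lam θ₀ π₀ θ gθ π gπ)
    (ho : IsUnbiasedOracle μ ℱ f T σ G θ gθ π gπ)
    (hselm : Measurable sel) (hsel : ∀ y, sel y ∈ stdSimplex ℝ (Fin n)) {t : ℕ} (ht : t < T) :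
    let e : Ω → ℝ := fun ω =>
      2 * inner ℝ (gradient (moreauEnvelope (primal f h) (1 / (2 * L))) (θ t ω))
          (gradient (fun y => f y (π t ω)) (θ t ω) - gθ t ω)
        + 2 * L * η * ‖gθ t ω‖ ^ 2
        + 4 * L * (2 * l * ‖θ t ω - θ (t - t % B) ω‖
          + ∑ i, (sel (θ (t - t % B) ω) i - π t ω i) * ((μ[gπ t | ℱ t]) ω i - gπ t ω i)
          + lam * ‖gπ t ω‖ ^ 2)
    Integrable e μ ∧ ∫ ω, e ω ∂μ ≤ 2 * L * η * (l ^ 2 + σ ^ 2)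
      + 4 * L * (2 * l * (η * (t % B : ℕ) * Real.sqrt (l ^ 2 + σ ^ 2)) + lam * G ^ 2) := by
  intro e
  set M := moreauEnvelope (primal f h) (1 / (2 * L)) with hM
  have hF := abs_primal_sub_le hΦ hne
  have hwc := isWeaklyConvex_primal hΦ hne
  have hgi : ∀ t < T, Integrable (gθ t) μ := fun t ht => (ho.memLp_θ t ht).integrable one_le_two
  have hγi : Integrable (gπ t) μ := (ho.memLp_π t ht).integrable one_le_two
  have hs : t - t % B ≤ t := Nat.sub_le _ _
  -- descent noise
  have hXm : StronglyMeasurable[ℱ t] fun ω => gradient M (θ t ω) :=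
    ((measurable_gradient M).comp (hrun.measurable_θ t ht.le)).stronglyMeasurable
  have hXb : ∀ᵐ ω ∂μ, ‖gradient M (θ t ω)‖ ≤ 2 * l :=
    Filter.Eventually.of_forall fun ω => norm_gradient_moreau_le hL hl hF hwc _
  have hi1 : Integrable (fun ω => inner ℝ (gradient M (θ t ω)) ((μ[gθ t | ℱ t]) ω - gθ t ω)) μ :=
    ContinuousLinearMap.integrable_of_bilin_of_bdd_left (innerSL ℝ) (2 * l)
      (hXm.mono (ℱ.le t)).aestronglyMeasurable hXb (integrable_condExp.sub (hgi t ht))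
  have h1 : ∫ ω, inner ℝ (gradient M (θ t ω)) ((μ[gθ t | ℱ t]) ω - gθ t ω) ∂μ = 0 :=
    integral_bilin_condExp_sub_eq_zero (innerSL ℝ) (ℱ.le t) hXm hXb (hgi t ht)
  -- the ascent noise
  have hYm : StronglyMeasurable[ℱ t] fun ω => sel (θ (t - t % B) ω) - π t ω := by
    refine Measurable.stronglyMeasurable (Measurable.sub ?_ (hrun.measurable_π t ht.le))
    -- The comparator depends only on `θ` at the start of the block, which is not later than `t`, so
    -- it is `ℱ t`-measurable.
    exact hselm.comp ((hrun.measurable_θ _ (hs.trans ht.le)).mono (ℱ.mono hs) le_rfl)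
  have hYb : ∀ᵐ ω ∂μ, ‖sel (θ (t - t % B) ω) - π t ω‖ ≤ 2 := by
    filter_upwards [hrun.mem_stdSimplex ht.le] with ω hω
    refine (norm_sub_le _ _).trans ?_
    linarith [norm_le_one_of_mem_stdSimplex hω,
      norm_le_one_of_mem_stdSimplex (hsel (θ (t - t % B) ω))]
  have hi2 := (dotBilin n).integrable_of_bilin_of_bdd_left 2
    ((hYm.mono (ℱ.le t)).aestronglyMeasurable (μ := μ)) hYb
    ((integrable_condExp (m := ℱ t) (f := gπ t)).sub hγi)
  have h2 := integral_bilin_condExp_sub_eq_zero (dotBilin n) (ℱ.le t) hYm hYb hγi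
  simp only [Pi.sub_apply, dotBilin_apply] at hi2 h2
  -- second moments and drift
  have hi3 : Integrable (fun ω => ‖gθ t ω‖ ^ 2) μ :=
    (ho.memLp_θ t ht).integrable_norm_pow two_ne_zero
  have h3 := ho.integral_norm_sq_le hl hΦ hrun ht
  have hi4 : Integrable (fun ω => ‖gπ t ω‖ ^ 2) μ :=
    (ho.memLp_π t ht).integrable_norm_pow two_ne_zero
  have h4 := ho.bound_π t ht
  have hdrift := integrable_norm_sub_and_integral_le (s := t - t % B) (k := t % B) hη.le
    hrun.step_θ hgi
    (fun t ht => integral_norm_le_sqrt (ho.memLp_θ t ht) (ho.integral_norm_sq_le hl hΦ hrun ht))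
    (by rw [Nat.sub_add_cancel (Nat.mod_le t B)]; exact ht.le)
  rw [Nat.sub_add_cancel (Nat.mod_le t B)] at hdrift
  obtain ⟨hi5, h5⟩ := hdrift
  have heq : e =ᵐ[μ] fun ω => 2 * inner ℝ (gradient M (θ t ω)) ((μ[gθ t | ℱ t]) ω - gθ t ω)
      + 2 * L * η * ‖gθ t ω‖ ^ 2
      + 4 * L * (2 * l * ‖θ t ω - θ (t - t % B) ω‖
        + ∑ i, (sel (θ (t - t % B) ω) i - π t ω i) * ((μ[gπ t | ℱ t]) ω i - gπ t ω i)
        + lam * ‖gπ t ω‖ ^ 2) := by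
    filter_upwards [ho.unbiased_θ t ht] with ω hω
    simp only [e, hω, hM]
  obtain ⟨hint, hval⟩ := integral_linearCombination hi1 hi3 hi5.norm hi2 hi4 2 (2 * L * η) (4 * L)
    (2 * l) lam
  refine ⟨hint.congr heq.symm, ?_⟩
  rw [integral_congr_ae heq, hval, h1, h2]
  have h3' := mul_le_mul_of_nonneg_left h3 (by positivity : 0 ≤ 2 * L * η)
  have h4' := mul_le_mul_of_nonneg_left h4 hlam.le
  have h5' := mul_le_mul_of_nonneg_left h5 (by positivity : 0 ≤ 2 * l)
  have h6 : 0 ≤ 4 * L := by positivity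
  have h7 := mul_le_mul_of_nonneg_left (add_le_add h5' h4') h6
  linarith

/-- Convergence estimate for arbitrary step sizes and an arbitrary block length `B`. -/
lemma sum_integral_norm_sq_gradient_moreau_le {B N : ℕ} {R α : ℝ} {pEmp : Fin n → ℝ}
    (hL : 0 < L) (hl : 0 ≤ l) (hR : 0 ≤ R) (hΦ : IsRegularObjective f h L l)
    (hF : BddBelow (Set.range (primal f h))) (hη : 0 < η) (hlam : 0 < lam)
    (hpEmp : pEmp ∈ stdSimplex ℝ (Fin n)) (hα : 0 < α) (hαp : ∀ i, α ≤ pEmp i)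
    (hrun : IsRun μ ℱ h T η lam θ₀ π₀ θ gθ π gπ)
    (ho : IsUnbiasedOracle μ ℱ f T σ G θ gθ π gπ)
    (hKL : ∀ t < T, ∀ᵐ ω ∂μ, klDiv pEmp (π t ω) ≤ (R : EReal)) (hB : 0 < B) (hTN : T ≤ N * B) :
    ∑ t ∈ Finset.range T,
        ∫ ω, ‖gradient (moreauEnvelope (primal f h) (1 / (2 * L))) (θ t ω)‖ ^ 2 ∂μ
      ≤ 2 * (moreauEnvelope (primal f h) (1 / (2 * L)) θ₀
          - ⨅ y, moreauEnvelope (primal f h) (1 / (2 * L)) y) / η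
        + 4 * L * (N * (1 / (2 * lam) * ((R + 1) / α))
          + (sSup (h '' stdSimplex ℝ (Fin n)) - h π₀))
        + T * (2 * L * η * (l ^ 2 + σ ^ 2) + 4 * L * (lam * G ^ 2))
        + 4 * L * (l * η * Real.sqrt (l ^ 2 + σ ^ 2) * (T * (B - 1))) := by
  have hne : (stdSimplex ℝ (Fin n)).Nonempty := ⟨_, hpEmp⟩
  have hFl := abs_primal_sub_le hΦ hne
  have hwc := isWeaklyConvex_primal hΦ hne
  -- The comparators are only `δ`-optimal; an arbitrary slack `ε` absorbs their total cost `4L * T *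
  -- δ`.
  refine le_of_forall_pos_le_add fun ε hε => ?_
  have hδ : 0 < ε / (4 * L * (T + 1)) := by positivity
  obtain ⟨sel, hselm, hsel⟩ := exists_measurable_nearly_optimal hΦ hne hδ
  set δ := ε / (4 * L * (T + 1)) with hδ_def
  have hδε : 4 * L * (T * δ) ≤ ε := by
    have : 4 * L * ((T + 1) * δ) = ε := by rw [hδ_def]; field_simp
    nlinarith
  have he := fun t (ht : t < T) => integrable_stepError_and_integral_le (B := B) hL hl hΦ hne hη
    hlam hrun ho hselm (fun y => (hsel y).1) ht
  have hMi : ∀ t ∈ Finset.range T, Integrable (fun ω =>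
      ‖gradient (moreauEnvelope (primal f h) (1 / (2 * L))) (θ t ω)‖ ^ 2) μ := fun t ht =>
    (memLp_gradient_moreau hL hl hFl hwc ((hrun.measurable_θ t
      (Finset.mem_range.1 ht).le).mono (ℱ.le t) le_rfl)).integrable_norm_pow two_ne_zero
  have hmem : ∀ᵐ ω ∂μ, ∀ t, t ≤ T → π t ω ∈ stdSimplex ℝ (Fin n) :=
    ae_all_iff.2 fun t => Filter.eventually_imp_distrib_left.2 fun ht => hrun.mem_stdSimplex ht
  have hall : ∀ᵐ ω ∂μ, ∀ t, t < T → θ (t + 1) ω = θ t ω - η • gθ t ω ∧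
      IsMirrorStep h lam (gπ t ω) (π t ω) (π (t + 1) ω) ∧
      HasSimplexGradientAt (f (θ t ω)) ((μ[gπ t | ℱ t]) ω) (π t ω) ∧
      klDiv pEmp (π t ω) ≤ (R : EReal) :=
    ae_all_iff.2 fun t => Filter.eventually_imp_distrib_left.2 fun ht => by
      filter_upwards [hrun.step_θ t ht, hrun.step_π t ht, ho.unbiased_π t ht, hKL t ht]
        with ω h1 h2 h3 h4 using ⟨h1, h2, h3, h4⟩
  have hpath := fun ω (h1 : ∀ t, t ≤ T → π t ω ∈ stdSimplex ℝ (Fin n))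
      (h2 : ∀ t, t < T → θ (t + 1) ω = θ t ω - η • gθ t ω ∧
      IsMirrorStep h lam (gπ t ω) (π t ω) (π (t + 1) ω) ∧
      HasSimplexGradientAt (f (θ t ω)) ((μ[gπ t | ℱ t]) ω) (π t ω) ∧
      klDiv pEmp (π t ω) ≤ (R : EReal)) =>
    sum_norm_sq_gradient_moreau_le (x := fun t => θ t ω) (p := fun t => π t ω)
      (g := fun t => gθ t ω) (γ := fun t => gπ t ω) (v := fun t => (μ[gπ t | ℱ t]) ω)
      (K := (R + 1) / α) hL hl hΦ hne hF hη hlam (by positivity) (fun t ht => (h2 t ht).1)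
      (fun t ht => (h2 t ht).2.1) h1
      (fun t ht => pos_of_klDiv_le (fun i => hα.trans_le (hαp i)) (h1 t ht.le).1 (h2 t ht).2.2.2)
      (fun t ht q hq => klSum_le_of_klDiv_le hpEmp hα hαp (h1 t ht.le) hq (h2 t ht).2.2.2)
      (fun t ht => (h2 t ht).2.2.1) hsel hTN
  have hei := integrable_finsetSum _ fun t ht => (he t (Finset.mem_range.1 ht)).1
  have hint := integral_mono_ae (integrable_finsetSum _ hMi)
    ((integrable_const (2 * (moreauEnvelope (primal f h) (1 / (2 * L)) θ₀
          - ⨅ y, moreauEnvelope (primal f h) (1 / (2 * L)) y) / η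
        + 4 * L * (N * (1 / (2 * lam) * ((R + 1) / α))
          + (sSup (h '' stdSimplex ℝ (Fin n)) - h π₀) + T * δ))).add hei)
    (by
      filter_upwards [hmem, hall] with ω h1 h2
      have := hpath ω h1 h2
      rw [hrun.init_θ, hrun.init_π] at this
      exact this)
  rw [integral_finsetSum _ hMi] at hint
  refine hint.trans ?_
  refine (le_of_eq (integral_add (integrable_const _) hei)).trans ?_
  rw [integral_const, probReal_univ, one_smul,
    integral_finsetSum _ fun t ht => (he t (Finset.mem_range.1 ht)).1]
  have hsum := Finset.sum_le_sum fun t ht => (he t (Finset.mem_range.1 ht)).2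
  have hmod := two_mul_sum_mod_le T hB
  have hrhs : ∑ t ∈ Finset.range T, (2 * L * η * (l ^ 2 + σ ^ 2)
      + 4 * L * (2 * l * (η * (t % B : ℕ) * Real.sqrt (l ^ 2 + σ ^ 2)) + lam * G ^ 2))
      = T * (2 * L * η * (l ^ 2 + σ ^ 2) + 4 * L * (lam * G ^ 2))
        + 4 * L * (l * η * Real.sqrt (l ^ 2 + σ ^ 2)
          * (2 * ∑ t ∈ Finset.range T, ((t % B : ℕ) : ℝ))) := by
    have hc : ∀ c : ℝ, T * c = ∑ _t ∈ Finset.range T, c := fun c => by simp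
    rw [hc, Finset.mul_sum, Finset.mul_sum, Finset.mul_sum, ← Finset.sum_add_distrib]
    exact Finset.sum_congr rfl fun t _ => by ring
  rw [hrhs] at hsum
  have hmod' := mul_le_mul_of_nonneg_left (mul_le_mul_of_nonneg_left hmod
    (by positivity : 0 ≤ l * η * Real.sqrt (l ^ 2 + σ ^ 2))) (by positivity : 0 ≤ 4 * L)
  linear_combination hsum + hmod' + hδε

end Run

/-! ### Choice of parameters and the final rate -/

/-- The general estimate at step sizes `r ^ (-3)`, `r ^ (-1)` and block length `⌈r ^ 2⌉`, where
`T = r ^ 4`. -/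
lemma rate_of_sum_le {A D H K S V G L l r : ℝ} {B : ℕ} (hr : 1 ≤ r) (hL : 0 ≤ L) (hl : 0 ≤ l)
    (hK : 0 ≤ K) (hS : 0 ≤ S) (hB : (B : ℝ) ≤ r ^ 2 + 1)
    (hA : A ≤ 2 * D / r⁻¹ ^ 3 + 4 * L * (B * (1 / (2 * r⁻¹) * K) + H)
      + r ^ 4 * (2 * L * r⁻¹ ^ 3 * V + 4 * L * (r⁻¹ * G ^ 2))
      + 4 * L * (l * r⁻¹ ^ 3 * S * (r ^ 4 * (B - 1)))) (hV : 0 ≤ V) :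
    1 / r ^ 4 * A ≤ (2 * D + 4 * L * (K + G ^ 2 + l * S) + 2 * L * V) * r⁻¹ + 4 * L * H / r ^ 4 := by
  have hr0 : 0 < r := by linarith
  have h1 : 1 / r ^ 4 * A ≤ 1 / r ^ 4 * _ := mul_le_mul_of_nonneg_left hA (by positivity)
  refine h1.trans ?_
  -- Rounding up gives `B ≤ r² + 1 ≤ 2r²`; the factor `2` cancels the one in `1 / (2λ)`. In the
  -- drift term `B - 1 ≤ r²`, so rounding costs nothing there.
  have hBK : 4 * L * (B * K) ≤ 4 * L * (2 * r ^ 2 * K) := by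
    gcongr
    nlinarith
  have hBS : 4 * L * (l * S * (B - 1)) ≤ 4 * L * (l * S * r ^ 2) := by
    gcongr
    linarith
  have hLV : 2 * L * V * 1 ≤ 2 * L * V * r ^ 2 := by
    gcongr
    nlinarith
  have e1 : 1 / r ^ 4 * (2 * D / r⁻¹ ^ 3 + 4 * L * (B * (1 / (2 * r⁻¹) * K) + H)
      + r ^ 4 * (2 * L * r⁻¹ ^ 3 * V + 4 * L * (r⁻¹ * G ^ 2))
      + 4 * L * (l * r⁻¹ ^ 3 * S * (r ^ 4 * (B - 1))))
      = (2 * D * r ^ 2 + (4 * L * (B * K)) / 2 + 2 * L * V * 1 + 4 * L * G ^ 2 * r ^ 2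
        + 4 * L * (l * S * (B - 1))) * r⁻¹ ^ 3 + 4 * L * H / r ^ 4 := by
    field_simp
    ring
  have e2 : (2 * D + 4 * L * (K + G ^ 2 + l * S) + 2 * L * V) * r⁻¹
      = (2 * D * r ^ 2 + (4 * L * (2 * r ^ 2 * K)) / 2 + 2 * L * V * r ^ 2 + 4 * L * G ^ 2 * r ^ 2
        + 4 * L * (l * S * r ^ 2)) * r⁻¹ ^ 3 := by
    field_simp
    ring
  rw [e1, e2]
  gcongr

lemma le_sq_of_pow_four_mul_le {C ε r : ℝ} (hε : 0 < ε) (hr : 0 < r)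
    (h : C ^ 4 * ε ^ (-8 : ℤ) ≤ r ^ 4) : C * r⁻¹ ≤ ε ^ 2 := by
  have h1 : C ^ 4 ≤ (ε ^ 2 * r) ^ 4 := by
    have h2 : ε ^ (-8 : ℤ) = (ε ^ 8)⁻¹ := by
      rw [zpow_neg]; norm_cast
    rw [h2, ← div_eq_mul_inv, div_le_iff₀ (by positivity)] at h
    linarith [h]
  have h3 : C ≤ ε ^ 2 * r := le_of_pow_le_pow_left₀ (by norm_num) (by positivity) h1
  rw [← div_eq_mul_inv, div_le_iff₀ hr]
  exact h3

/-- Jensen's inequality for an average of expectations. -/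
lemma average_integral_norm_le {Ω : Type*} {mΩ : MeasurableSpace Ω} {μ : Measure Ω}
    [IsProbabilityMeasure μ] {E : Type*} [NormedAddCommGroup E] {X : ℕ → Ω → E} {T : ℕ} {ε : ℝ}
    (hT : 1 ≤ T) (hε : 0 ≤ ε) (hX : ∀ t < T, MemLp (X t) 2 μ)
    (h : 1 / (T : ℝ) * ∑ t ∈ Finset.range T, ∫ ω, ‖X t ω‖ ^ 2 ∂μ ≤ ε ^ 2) :
    1 / (T : ℝ) * ∑ t ∈ Finset.range T, ∫ ω, ‖X t ω‖ ∂μ ≤ ε := by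
  have hT0 : (0 : ℝ) < T := by exact_mod_cast hT
  have h1 : ∑ t ∈ Finset.range T, (∫ ω, ‖X t ω‖ ∂μ) ^ 2
      ≤ ∑ t ∈ Finset.range T, ∫ ω, ‖X t ω‖ ^ 2 ∂μ := by
    refine Finset.sum_le_sum fun t ht => ?_
    have h2 := integral_norm_le_sqrt (hX t (Finset.mem_range.1 ht)) le_rfl
    have h3 : 0 ≤ ∫ ω, ‖X t ω‖ ∂μ := integral_nonneg fun _ => norm_nonneg _
    have h4 : 0 ≤ ∫ ω, ‖X t ω‖ ^ 2 ∂μ := integral_nonneg fun _ => by positivity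
    calc (∫ ω, ‖X t ω‖ ∂μ) ^ 2 ≤ (Real.sqrt (∫ ω, ‖X t ω‖ ^ 2 ∂μ)) ^ 2 := by gcongr
      _ = _ := Real.sq_sqrt h4
  have h2 := sq_sum_le_card_mul_sum_sq (s := Finset.range T) (f := fun t => ∫ ω, ‖X t ω‖ ∂μ)
  rw [Finset.card_range] at h2
  refine le_of_pow_le_pow_left₀ two_ne_zero hε ?_
  rw [one_div, inv_mul_le_iff₀ hT0] at h
  rw [one_div, inv_mul_eq_div, div_pow, div_le_iff₀ (by positivity)]
  nlinarith

end SaddlePoint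

theorem theorem1
    {d n : ℕ} {Ω : Type*} {mΩ : MeasurableSpace Ω} (μ : Measure Ω) [IsProbabilityMeasure μ]
    (ℱ : Filtration ℕ mΩ)
    (f : EuclideanSpace ℝ (Fin d) → (Fin n → ℝ) → ℝ) (h : (Fin n → ℝ) → ℝ)
    (L l σ G R α : ℝ) (hL : 0 < L) (hl : 0 ≤ l) (hσ : 0 ≤ σ) (hG : 0 ≤ G) (hR : 0 ≤ R)
    (hΦ : SaddlePoint.IsRegularObjective f h L l)
    (hF : BddBelow (Set.range (SaddlePoint.primal f h)))
    (pEmp : Fin n → ℝ) (hpEmp : pEmp ∈ stdSimplex ℝ (Fin n))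
    (hα : 0 < α) (hαp : ∀ i, α ≤ pEmp i)
    (T : ℕ) (hT : 1 ≤ T)
    (θ₀ : EuclideanSpace ℝ (Fin d)) (π₀ : Fin n → ℝ)
    (θ gθ : ℕ → Ω → EuclideanSpace ℝ (Fin d)) (π gπ : ℕ → Ω → Fin n → ℝ)
    (hrun : SaddlePoint.IsRun μ ℱ h T ((T : ℝ) ^ (-(3 / 4) : ℝ)) ((T : ℝ) ^ (-(1 / 4) : ℝ))
      θ₀ π₀ θ gθ π gπ)
    (horacle : SaddlePoint.IsUnbiasedOracle μ ℱ f T σ G θ gθ π gπ)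
    (hKL : ∀ t < T, ∀ᵐ ω ∂μ, SaddlePoint.klDiv pEmp (π t ω) ≤ (R : EReal)) :
    let M : EuclideanSpace ℝ (Fin d) → ℝ :=
      SaddlePoint.moreauEnvelope (SaddlePoint.primal f h) (1 / (2 * L))
    let D : ℝ := M θ₀ - ⨅ x, M x
    let H : ℝ := sSup (h '' stdSimplex ℝ (Fin n)) - h π₀
    let C : ℝ := SaddlePoint.rateConst L l σ G R α D
    Differentiable ℝ M ∧
    (∀ t < T, Integrable (fun ω => ‖gradient M (θ t ω)‖ ^ 2) μ) ∧
    (1 / (T : ℝ)) * ∑ t ∈ Finset.range T, ∫ ω, ‖gradient M (θ t ω)‖ ^ 2 ∂μ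
      ≤ C * (T : ℝ) ^ (-(1 / 4) : ℝ) + 4 * L * H / T ∧
    (∀ ε : ℝ, 0 < ε → (C + 4 * L * H) ^ 4 * ε ^ (-8 : ℤ) ≤ T →
      (1 / (T : ℝ)) * ∑ t ∈ Finset.range T, ∫ ω, ‖gradient M (θ t ω)‖ ∂μ ≤ ε ∧
      ∃ t < T, ∫ ω, ‖gradient M (θ t ω)‖ ∂μ ≤ ε) := by
  intro M D H C
  have hne : (stdSimplex ℝ (Fin n)).Nonempty := ⟨_, hpEmp⟩
  have hFl := SaddlePoint.abs_primal_sub_le hΦ hne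
  have hwc := SaddlePoint.isWeaklyConvex_primal hΦ hne
  have hMLp : ∀ t < T, MemLp (fun ω => gradient M (θ t ω)) 2 μ := fun t ht =>
    SaddlePoint.memLp_gradient_moreau hL hl hFl hwc
      ((hrun.measurable_θ t ht.le).mono (ℱ.le t) le_rfl)
  have hT0 : (0 : ℝ) ≤ T := T.cast_nonneg
  have hT1 : (1 : ℝ) ≤ T := by exact_mod_cast hT
  set r : ℝ := (T : ℝ) ^ (1 / 4 : ℝ) with hr_def
  have hr1 : 1 ≤ r := Real.one_le_rpow hT1 (by norm_num)
  have hr0 : 0 < r := by linarith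
  have hr4 : (T : ℝ) = r ^ 4 := by
    rw [hr_def, ← Real.rpow_natCast, ← Real.rpow_mul hT0]; norm_num
  have hlam : (T : ℝ) ^ (-(1 / 4) : ℝ) = r⁻¹ := by rw [Real.rpow_neg hT0]
  have hη : (T : ℝ) ^ (-(3 / 4) : ℝ) = r⁻¹ ^ 3 := by
    rw [← hlam, ← Real.rpow_natCast, ← Real.rpow_mul hT0]; norm_num
  rw [hlam, hη] at hrun
  -- Block length about `√T` balances the drift `ηB` against the regret `1 / (λB)`. As `T ≤ B * B`,
  -- `B` blocks suffice.
  set B : ℕ := ⌈r ^ 2⌉₊ with hB_def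
  have hB0 : 0 < B := Nat.ceil_pos.2 (by positivity)
  have hB1 : (B : ℝ) ≤ r ^ 2 + 1 := (Nat.ceil_lt_add_one (by positivity)).le
  have hTB : T ≤ B * B := by
    have h1 : r ^ 2 ≤ B := Nat.le_ceil _
    have h2 : (T : ℝ) ≤ B * B := by rw [hr4]; nlinarith [sq_nonneg r]
    exact_mod_cast h2
  have hsum := SaddlePoint.sum_integral_norm_sq_gradient_moreau_le hL hl hR hΦ hF (by positivity)
    (by positivity) hpEmp hα hαp hrun horacle hKL hB0 hTB
  have hrate : 1 / (T : ℝ) * ∑ t ∈ Finset.range T, ∫ ω, ‖gradient M (θ t ω)‖ ^ 2 ∂μ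
      ≤ C * r⁻¹ + 4 * L * H / T := by
    rw [hr4] at hsum ⊢
    exact SaddlePoint.rate_of_sum_le hr1 hL.le hl (by positivity) (Real.sqrt_nonneg _) hB1 hsum
      (by positivity)
  refine ⟨SaddlePoint.differentiable_moreau hL hl hFl hwc,
    fun t ht => (hMLp t ht).integrable_norm_pow two_ne_zero, by rwa [hlam], fun ε hε hTε => ?_⟩
  have hH : 0 ≤ H := sub_nonneg.2 (le_csSup ((isCompact_stdSimplex (𝕜 := ℝ)
    (ι := Fin n)).bddAbove_image hΦ.continuous_h) (Set.mem_image_of_mem _ hrun.init_mem))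
  have havg : 1 / (T : ℝ) * ∑ t ∈ Finset.range T, ∫ ω, ‖gradient M (θ t ω)‖ ∂μ ≤ ε := by
    refine SaddlePoint.average_integral_norm_le hT hε.le hMLp (hrate.trans ?_)
    -- Since `T = r⁴ ≥ r`, the `1 / T` term joins the leading one, which explains the constant `C +
    -- 4 * L * H` in the condition on `T`.
    have h1 : 4 * L * H / T ≤ 4 * L * H * r⁻¹ := by
      rw [div_eq_mul_inv, hr4]
      gcongr
      exact le_self_pow₀ hr1 (by norm_num)
    have h2 := SaddlePoint.le_sq_of_pow_four_mul_le hε hr0 (hTε.trans_eq hr4)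
    linarith
  refine ⟨havg, ?_⟩
  by_contra! hcon
  have hlt := Finset.sum_lt_sum_of_nonempty (s := Finset.range T)
    (Finset.nonempty_range_iff.2 (by omega)) fun t ht => hcon t (Finset.mem_range.1 ht)
  rw [Finset.sum_const, Finset.card_range, nsmul_eq_mul] at hlt
  rw [one_div, inv_mul_le_iff₀ (by linarith)] at havg
  linarith
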